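/- Conventions. For possibly undefined expressions $e',e$ with values in a poset, $e'\preceq e$ means: if $e$ is defined, then so is $e'$, and $e'\le e$; an assertion $e'\leq e$ or $e'\in X$ includes that the expressions are defined. A *PCA* (relative, ordered) is a poset $A$ with a partial application $(a,b)\mapsto ab$ such that $a'\le a$, $b'\le b$ imply $a'b'\preceq ab$, and with a filter $A^\#\subseteq A$ (a non-empty, upwards closed subset, closed under defined application) containing elements $\mathsf k,\mathsf s$ with $\mathsf kab\le a$, $\mathsf sab$ defined, and $\mathsf sabc\preceq ac(bc)$. Choices of $\mathsf k,\mathsf s$ are fixed, and $\mathsf i=\mathsf{skk}$, $\top=\mathsf k$, $\bot=\mathsf{ki}$. Let $\mathsf p,\mathsf p_0,\mathsf p_1$ be the standard pairing and unpairing combinators $\lambda^*xyz.zxy$, $\lambda^*x.x\top$, $\lambda^*x.x\bot$; numerals are $\overline 0=\mathsf i$, $\overline{n+1}=\mathsf p\bot\overline n$, and sequences are coded by $[a_0,\dots,a_{n-1}]=\mathsf p\,\overline n\,(\mathsf pa_0(\mathsf pa_1(\cdots(\mathsf pa_{n-1}\mathsf i)\cdots)))$. $A$ is *semitrivial* if $\top,\bot$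 have a common lower bound, and *chain-complete* if every chain (non-empty totally ordered subset) has a greatest lower bound. $\mathcal BA$ is the set of partial functions $\alpha\colon A\rightharpoonup A$ such that $a\le b$ implies $\alpha(a)\preceq\alpha(b)$, ordered by $\alpha\le\beta$ iff $\alpha(a)\preceq\beta(a)$ for all $a$; $\mathcal B_2A$ is the set of partial functions $F\colon\mathcal BA\rightharpoonup A$ such that $\alpha\le\beta$ implies $F(\alpha)\preceq F(\beta)$. Let $A$ be a non-semitrivial PCA and $f\in\mathcal BA$. Put $a\odot_f b=c$ iff there is a finite (possibly empty) sequence $u_0,\dots,u_{n-1}$ in $A$ such that $\mathsf p_0(a\cdot[b,u_0,\dots,u_{i-1}])\le\bot$ and $f(\mathsf p_1(a\cdot[b,u_0,\dots,u_{i-1}]))=u_i$ for all $i<n$, while $\mathsf p_0(a\cdot[b,u_0,\dots,u_{n-1}])\le\top$ and $\mathsf p_1(a\cdot[b,u_0,\dots,u_{n-1}])=c$. Then $A[f]$ is the poset $A$ with application $\odot_f$ and with $A[f]^\#$ the filter generated by $A^\#$ with respect to $\odot_f$. $DB$ is the set of downwards closed subsets of $B$. For $X,Y\in DB$, $XY$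 is defined iff $xy$ is defined for all $x\in X,y\in Y$, and is then the downwards closure of the set of these $xy$; for $b\in B$, $bY$ means $(\downarrow\!\{b\})Y$. A *partial applicative morphism* $g\colon A\rightharpoonup B$ is a function $g\colon A\to DB$ such that: (1) $g(a)\cap B^\#\ne\emptyset$ for $a\in A^\#$; (2) for some $t\in B^\#$, $t\,g(a)\,g(a')$ is defined and contained in $g(aa')$ whenever $aa'$ is defined; (3) for some $u\in B^\#$, $u\,g(a)$ is always defined, and contained in $g(a')$ whenever $a\le a'$. It is *total* if all $g(a)$ are non-empty; *decidable* if for some $d\in B^\#$, $d\,g(\top)\subseteq\,\downarrow\!\{\top\}$ and $d\,g(\bot)\subseteq\,\downarrow\!\{\bot\}$; *chain-continuous* (for $A$ chain-complete) if $g(\bigwedge X)=\bigcap_{a\in X}g(a)$ for every chain $X\subseteq A$. Composition is $hg(a)=\bigcup_{b\in g(a)}h(b)$; $g\le g'$ means that for some $r\in B^\#$, $r\,g(a)$ is defined and contained in $g'(a)$ for all $a$; $g\simeq g'$ means $g\le g'$ and $g'\le g$. An element $b\in B$ *represents* $\alpha\in\mathcal BA$ w.r.t. $g$ if $b\,g(a)$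 is defined and contained in $g(\alpha(a))$ for all $a\in\operatorname{dom}\alpha$. A functional $F\in\mathcal B_2A$ is *effectively representable* w.r.t. $g$ if there is $r\in B^\#$ such that $rb\in g(F(\alpha))$ whenever $\alpha\in\operatorname{dom}F$ and $b\in B$ represents $\alpha$ w.r.t. $g$. **Theorem.** Let $A$ be a chain-complete, non-semitrivial PCA, let $F\in\mathcal B_2A$, and let $\tilde F\colon\mathcal BA\to\mathcal BA$ be the order-preserving map $\tilde F(\alpha)(a)\simeq F(\lambda a'.\,a\odot_\alpha a')$. Then $\tilde F$ has a largest fixpoint $f\in\mathcal BA$. The structure $A[f]$ is a non-semitrivial PCA, the map $\iota_f(a)=\,\downarrow\!\{a\}$ is a total applicative morphism $A\to A[f]$, and: (i) $F$ is effectively representable w.r.t. $\iota_f\colon A\to A[f]$; (ii) for every PCA $B$ and every decidable, chain-continuous partial applicative morphism $g\colon A\rightharpoonup B$ with respect to which $F$ is effectively representable, there is a partial applicative morphism $h\colon A[f]\rightharpoonup B$ with $h\iota_f\simeq g$. -/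

import Mathlib

universe u v w

namespace RelPCA

/-! Possibly undefined values of a poset are elements of `Part`. -/

/-- `x ≼ y`: if `y` is defined, then so is `x`, and `x ≤ y`. -/
def PLE {Y : Type u} [LE Y] (x y : Part Y) : Prop :=
  ∀ b ∈ y, ∃ a ∈ x, a ≤ b

theorem PLE.refl {Y : Type u} [Preorder Y] (x : Part Y) : PLE x x :=
  fun b hb => ⟨b, hb, le_rfl⟩

theorem PLE.trans {Y : Type u} [Preorder Y] {x y z : Part Y} (h : PLE x y) (h' : PLE y z) :
    PLE x z := by
  intro c hc
  obtain ⟨b, hb, hbc⟩ := h' c hc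
  obtain ⟨a, ha, hab⟩ := h b hb
  exact ⟨a, ha, hab.trans hbc⟩

theorem PLE.dom {Y : Type u} [LE Y] {x y : Part Y} (h : PLE x y) (hy : y.Dom) : x.Dom := by
  obtain ⟨a, ha, -⟩ := h _ (Part.get_mem hy)
  exact Part.dom_iff_mem.2 ⟨a, ha⟩

theorem PLE.antisymm {Y : Type u} [PartialOrder Y] {x y : Part Y} (h : PLE x y) (h' : PLE y x) :
    x = y := by
  have key : ∀ {x y : Part Y}, PLE x y → PLE y x → ∀ b ∈ y, b ∈ x := by
    intro x y h h' b hb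
    obtain ⟨a, ha, hab⟩ := h b hb
    obtain ⟨b', hb', hba⟩ := h' a ha
    have : b' = b := Part.mem_unique hb' hb
    subst this
    rwa [le_antisymm hba hab]
  exact Part.ext fun b => ⟨key h' h b, key h h' b⟩

/-! ### Order-preserving partial functions -/

/-- Partial functions `φ` between posets such that `x ≤ y` implies `φ x ≼ φ y`. -/
@[ext]
structure MonoPFun (X : Type u) (Y : Type v) [PartialOrder X] [PartialOrder Y] where
  toFun : X → Part Y
  mono : ∀ ⦃x y : X⦄, x ≤ y → PLE (toFun x) (toFun y)

/-- `φ ≤ ψ` means that `φ x ≼ ψ x` for all `x`. -/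
instance {X : Type u} {Y : Type v} [PartialOrder X] [PartialOrder Y] :
    PartialOrder (MonoPFun X Y) where
  le φ ψ := ∀ x, PLE (φ.toFun x) (ψ.toFun x)
  le_refl φ x := PLE.refl _
  le_trans _ _ _ h h' x := (h x).trans (h' x)
  le_antisymm _ _ h h' := MonoPFun.ext (funext fun x => (h x).antisymm (h' x))

/-- The poset `𝓑A` of first-order functions on `A`. -/
abbrev Fn (A : Type u) [PartialOrder A] : Type u := MonoPFun A A

/-- The set `𝓑₂A` of second-order functionals on `A`. -/
abbrev Fn2 (A : Type u) [PartialOrder A] : Type u := MonoPFun (Fn A) A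

/-! ### Partial applicative posets and structures -/

/-- A partial applicative poset structure on the poset `A`. -/
structure PAP (A : Type u) [PartialOrder A] where
  app : A → A → Part A
  app_mono : ∀ ⦃a' a b' b : A⦄, a' ≤ a → b' ≤ b → PLE (app a' b') (app a b)

/-- A filter: a non-empty, upwards closed subset that is closed under defined application. -/
structure PAP.IsFilter {A : Type u} [PartialOrder A] (P : PAP A) (F : Set A) : Prop where
  nonempty : F.Nonempty
  app_mem : ∀ ⦃a b c : A⦄, a ∈ F → b ∈ F → c ∈ P.app a b → c ∈ F
  up : ∀ ⦃a b : A⦄, a ≤ b → a ∈ F → b ∈ F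

/-- The filter generated by a (non-empty) set. -/
def PAP.generate {A : Type u} [PartialOrder A] (P : PAP A) (X : Set A) : Set A :=
  {a | ∀ F : Set A, P.IsFilter F → X ⊆ F → a ∈ F}

theorem PAP.isFilter_generate {A : Type u} [PartialOrder A] (P : PAP A) {X : Set A}
    (hX : X.Nonempty) : P.IsFilter (P.generate X) where
  nonempty := hX.imp fun _ hx _ _ hXF => hXF hx
  app_mem _ _ _ ha hb hc F hF hXF := hF.app_mem (ha F hF hXF) (hb F hF hXF) hc
  up _ _ hab ha F hF hXF := hF.up hab (ha F hF hXF)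

/-- A partial applicative structure: a partial applicative poset with a filter `eff`
(written `A^#`) of effective elements. -/
structure PAS (A : Type u) [PartialOrder A] extends PAP A where
  eff : Set A
  isFilter_eff : toPAP.IsFilter eff

section

variable {A : Type u} [PartialOrder A]

/-- `(a b) c` -/
def PAP.app₂ (P : PAP A) (a b c : A) : Part A := (P.app a b).bind fun x => P.app x c

/-- `((a b) c) d` -/
def PAP.app₃ (P : PAP A) (a b c d : A) : Part A := (P.app₂ a b c).bind fun x => P.app x d

end

/-- A partial combinatory algebra structure (relative and ordered) on the poset `A`, with an
explicit choice of the combinators `k` and `s`. -/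
structure PCA (A : Type u) [PartialOrder A] extends PAS A where
  k : A
  s : A
  k_mem : k ∈ eff
  s_mem : s ∈ eff
  k_app : ∀ a b : A, ∃ c ∈ toPAP.app₂ k a b, c ≤ a
  s_dom : ∀ a b : A, (toPAP.app₂ s a b).Dom
  s_app : ∀ a b c : A,
    PLE (toPAP.app₃ s a b c) ((app a c).bind fun x => (app b c).bind fun y => app x y)

/-! ### Terms and the standard combinators -/

/-- Terms over `A`. -/
inductive Term (A : Type u) : Type u
  | var : ℕ → Term A
  | const : A → Term A
  | app : Term A → Term A → Term A

/-- The (possibly undefined) interpretation of a term. -/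
def PAP.eval {A : Type u} [PartialOrder A] (P : PAP A) (ρ : ℕ → A) : Term A → Part A
  | .var n => Part.some (ρ n)
  | .const a => Part.some a
  | .app t r => (P.eval ρ t).bind fun x => (P.eval ρ r).bind fun y => P.app x y

theorem PAP.bind_app_mono {A : Type u} [PartialOrder A] (P : PAP A) {x' x y' y : Part A}
    (hx : PLE x' x) (hy : PLE y' y) :
    PLE (x'.bind fun a => y'.bind fun b => P.app a b)
      (x.bind fun a => y.bind fun b => P.app a b) := by
  intro c hc
  obtain ⟨a, ha, hc⟩ := Part.mem_bind_iff.1 hc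
  obtain ⟨b, hb, hc⟩ := Part.mem_bind_iff.1 hc
  obtain ⟨a', ha', haa⟩ := hx a ha
  obtain ⟨b', hb', hbb⟩ := hy b hb
  obtain ⟨c', hc', hcc⟩ := P.app_mono haa hbb c hc
  exact ⟨c', Part.mem_bind_iff.2 ⟨a', ha', Part.mem_bind_iff.2 ⟨b', hb', hc'⟩⟩, hcc⟩

namespace PCA

variable {A : Type u} [PartialOrder A] (P : PCA A)

theorem k_dom (a : A) : (P.app P.k a).Dom := by
  obtain ⟨c, hc, -⟩ := P.k_app a a
  obtain ⟨x, hx, -⟩ := Part.mem_bind_iff.1 hc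
  exact Part.dom_iff_mem.2 ⟨x, hx⟩

/-- `i = s k k` -/
noncomputable def i : A := (P.app₂ P.s P.k P.k).get (P.s_dom _ _)

theorem i_app (a : A) : ∃ c ∈ P.app P.i a, c ≤ a := by
  obtain ⟨x, hx⟩ := Part.dom_iff_mem.1 (P.k_dom a)
  obtain ⟨c, hc, hca⟩ := P.k_app a x
  obtain ⟨x', hx', hc⟩ := Part.mem_bind_iff.1 hc
  obtain rfl := Part.mem_unique hx hx'
  obtain ⟨d, hd, hdc⟩ := P.s_app P.k P.k a c
    (Part.mem_bind_iff.2 ⟨x, hx, Part.mem_bind_iff.2 ⟨x, hx, hc⟩⟩)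
  obtain ⟨y, hy, hd⟩ := Part.mem_bind_iff.1 hd
  obtain rfl : P.i = y := Part.mem_unique (Part.get_mem _) hy
  exact ⟨d, hd, hdc.trans hca⟩

/-- The boolean `⊤ = k`. -/
def tt : A := P.k

/-- The boolean `⊥ = k i`. -/
noncomputable def ff : A := (P.app P.k P.i).get (P.k_dom _)

/-- `A` is semitrivial if `⊤` and `⊥` have a common lower bound. -/
def Semitrivial : Prop := ∃ x : A, x ≤ P.tt ∧ x ≤ P.ff

/-- The term `λ* n. t`. -/
noncomputable def abs {A : Type u} [PartialOrder A] (P : PCA A) (n : ℕ) : Term A → Term A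
  | .var m => if m = n then .const P.i else .app (.const P.k) (.var m)
  | .const a => .app (.const P.k) (.const a)
  | .app t r => .app (.app (.const P.s) (abs P n t)) (abs P n r)

theorem abs_dom (n : ℕ) (ρ : ℕ → A) (t : Term A) : (P.eval ρ (P.abs n t)).Dom := by
  induction t with
  | var m =>
    by_cases h : m = n
    · simp [abs, h, PAP.eval]
    · simpa [abs, h, PAP.eval] using P.k_dom _
  | const a => simpa [abs, PAP.eval] using P.k_dom _
  | app t r iht ihr =>
    obtain ⟨x, hx⟩ := Part.dom_iff_mem.1 iht
    obtain ⟨y, hy⟩ := Part.dom_iff_mem.1 ihr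
    obtain ⟨z, hz⟩ := Part.dom_iff_mem.1 (P.s_dom x y)
    obtain ⟨w, hw, hz⟩ := Part.mem_bind_iff.1 hz
    refine Part.dom_iff_mem.2 ⟨z, ?_⟩
    simp only [abs, PAP.eval, Part.bind_some]
    exact Part.mem_bind_iff.2 ⟨w, Part.mem_bind_iff.2 ⟨x, hx, hw⟩,
      Part.mem_bind_iff.2 ⟨y, hy, hz⟩⟩

theorem abs_app (n : ℕ) (ρ : ℕ → A) (t : Term A) (a : A) :
    PLE ((P.eval ρ (P.abs n t)).bind fun x => P.app x a)
      (P.eval (Function.update ρ n a) t) := by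
  induction t with
  | var m =>
    by_cases h : m = n
    · subst h
      simpa [abs, PAP.eval, PLE] using P.i_app a
    · simpa [abs, h, PAP.eval, PLE, PAP.app₂] using P.k_app (ρ m) a
  | const b => simpa [abs, PAP.eval, PLE, PAP.app₂] using P.k_app b a
  | app t r iht ihr =>
    refine PLE.trans ?_ (P.bind_app_mono iht ihr)
    obtain ⟨x, hx⟩ := Part.dom_iff_mem.1 (P.abs_dom n ρ t)
    obtain ⟨y, hy⟩ := Part.dom_iff_mem.1 (P.abs_dom n ρ r)
    have := P.s_app x y a
    rw [Part.eq_some_iff.2 hx, Part.eq_some_iff.2 hy]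
    simp only [abs, PAP.eval, Part.eq_some_iff.2 hx, Part.eq_some_iff.2 hy, Part.bind_some]
    exact this

/-- The interpretation of the closed term `λ* n. t`. -/
noncomputable def lam (n : ℕ) (t : Term A) : A := (P.eval (fun _ => P.k) (P.abs n t)).get
  (P.abs_dom _ _ _)

/-- The pairing combinator `p = λ* x y z. z x y`. -/
noncomputable def p : A :=
  P.lam 0 (P.abs 1 (P.abs 2 (.app (.app (.var 2) (.var 0)) (.var 1))))

/-- The unpairing combinator `p₀ = λ* x. x ⊤`. -/
noncomputable def p₀ : A := P.lam 0 (.app (.var 0) (.const P.tt))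

/-- The unpairing combinator `p₁ = λ* x. x ⊥`. -/
noncomputable def p₁ : A := P.lam 0 (.app (.var 0) (.const P.ff))

theorem pair_dom (a b : A) : (P.app₂ P.p a b).Dom := by
  have h1 := P.abs_app 0 (fun _ => P.k)
    (P.abs 1 (P.abs 2 (.app (.app (.var 2) (.var 0)) (.var 1)))) a
  rw [show P.eval (fun _ => P.k) (P.abs 0 (P.abs 1 (P.abs 2 (.app (.app (.var 2) (.var 0))
    (.var 1))))) = Part.some P.p from (Part.some_get _).symm, Part.bind_some] at h1
  have h2 := P.abs_app 1 (Function.update (fun _ => P.k) 0 a)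
    (P.abs 2 (.app (.app (.var 2) (.var 0)) (.var 1))) b
  have h3 := h2.dom (P.abs_dom _ _ _)
  obtain ⟨c, hc⟩ := Part.dom_iff_mem.1 h3
  obtain ⟨x, hx, hc⟩ := Part.mem_bind_iff.1 hc
  obtain ⟨y, hy, hyx⟩ := h1 x hx
  obtain ⟨z, hz, -⟩ := P.app_mono hyx (le_refl b) c hc
  exact Part.dom_iff_mem.2 ⟨z, Part.mem_bind_iff.2 ⟨y, hy, hz⟩⟩

/-- `p a b`, which is always defined. -/
noncomputable def pair (a b : A) : A := (P.app₂ P.p a b).get (P.pair_dom a b)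

theorem pair_mono {a' a b' b : A} (ha : a' ≤ a) (hb : b' ≤ b) : P.pair a' b' ≤ P.pair a b := by
  have hm : P.pair a b ∈ P.app₂ P.p a b := Part.get_mem _
  obtain ⟨x, hx, hm⟩ := Part.mem_bind_iff.1 hm
  obtain ⟨x', hx', hxx⟩ := P.app_mono (le_refl P.p) ha x hx
  obtain ⟨y, hy, hyy⟩ := P.app_mono hxx hb _ hm
  have : y = P.pair a' b' :=
    Part.mem_unique (Part.mem_bind_iff.2 ⟨x', hx', hy⟩) (Part.get_mem _)
  rwa [← this]

/-- The numerals: `0` is coded by `i`, and `n + 1` by `p ⊥ n`. -/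
noncomputable def num : ℕ → A
  | 0 => P.i
  | n + 1 => P.pair P.ff (num n)

/-- `j () = i` and `j (a₀, …, aₙ) = p a₀ (j (a₁, …, aₙ))`. -/
noncomputable def tuple : List A → A
  | [] => P.i
  | a :: l => P.pair a (tuple l)

/-- The code `[a₀, …, aₙ₋₁] = p n (j (a₀, …, aₙ₋₁))` of a finite sequence. -/
noncomputable def code (l : List A) : A := P.pair (P.num l.length) (P.tuple l)

theorem tuple_mono {l' l : List A} (h : List.Forall₂ (· ≤ ·) l' l) : P.tuple l' ≤ P.tuple l := by
  induction h with
  | nil => exact le_rfl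
  | cons h _ ih => exact P.pair_mono h ih

theorem code_mono {l' l : List A} (h : List.Forall₂ (· ≤ ·) l' l) : P.code l' ≤ P.code l := by
  unfold code
  rw [h.length_eq]
  exact P.pair_mono le_rfl (P.tuple_mono h)

/-! ### Computations with an oracle -/

/-- `p₀ (a · [b, u₀, …, uₙ₋₁]) ≤ t` and `p₁ (a · [b, u₀, …, uₙ₋₁]) = v`. -/
def Outputs (t a b : A) (us : List A) (v : A) : Prop :=
  ∃ e ∈ P.app a (P.code (b :: us)), (∃ x ∈ P.app P.p₀ e, x ≤ t) ∧ v ∈ P.app P.p₁ e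

/-- The sequence `us` is a `b`-interrogation of `f` by `a`, with final output `c`. -/
def IsInterrogation (f : Fn A) (a b : A) (us : List A) (c : A) : Prop :=
  (∀ (i : ℕ) (hi : i < us.length),
    ∃ v : A, P.Outputs P.ff a b (us.take i) v ∧ us[i] ∈ f.toFun v) ∧
  P.Outputs P.tt a b us c

variable {P}

theorem Outputs.unique {t t' a b : A} {us : List A} {v v' : A} (h : P.Outputs t a b us v)
    (h' : P.Outputs t' a b us v') : v = v' := by
  obtain ⟨e, he, -, hv⟩ := h
  obtain ⟨e', he', -, hv'⟩ := h'
  obtain rfl := Part.mem_unique he he'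
  exact Part.mem_unique hv hv'

theorem Outputs.absurd (hP : ¬ P.Semitrivial) {a b : A} {us : List A} {v v' : A}
    (h : P.Outputs P.ff a b us v) (h' : P.Outputs P.tt a b us v') : False := by
  obtain ⟨e, he, ⟨x, hx, hxt⟩, -⟩ := h
  obtain ⟨e', he', ⟨x', hx', hxt'⟩, -⟩ := h'
  obtain rfl := Part.mem_unique he he'
  obtain rfl := Part.mem_unique hx hx'
  exact hP ⟨x, hxt', hxt⟩

theorem Outputs.mono {t a b a' b' : A} {us us' : List A} {v : A} (ha : a' ≤ a) (hb : b' ≤ b)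
    (hu : List.Forall₂ (· ≤ ·) us' us) (h : P.Outputs t a b us v) :
    ∃ v' ≤ v, P.Outputs t a' b' us' v' := by
  obtain ⟨e, he, ⟨x, hx, hxt⟩, hv⟩ := h
  obtain ⟨e', he', hee⟩ := P.app_mono ha (P.code_mono (List.Forall₂.cons hb hu)) e he
  obtain ⟨x', hx', hxx⟩ := P.app_mono le_rfl hee x hx
  obtain ⟨v', hv', hvv⟩ := P.app_mono le_rfl hee v hv
  exact ⟨v', hvv, e', he', ⟨x', hx', hxx.trans hxt⟩, hv'⟩

theorem IsInterrogation.take_eq {f : Fn A} {a b : A} {us us' : List A} {c c' : A}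
    (h : P.IsInterrogation f a b us c) (h' : P.IsInterrogation f a b us' c') (n : ℕ)
    (hn : n ≤ us.length) (hn' : n ≤ us'.length) : us.take n = us'.take n := by
  induction n with
  | zero => simp
  | succ n ih =>
    have e := ih (by omega) (by omega)
    obtain ⟨v, hv, hu⟩ := h.1 n (by omega)
    obtain ⟨v', hv', hu'⟩ := h'.1 n (by omega)
    rw [e] at hv
    obtain rfl := hv.unique hv'
    have := Part.mem_unique hu hu'
    rw [List.take_succ_eq_append_getElem (by omega), List.take_succ_eq_append_getElem (by omega),
      e, this]

theorem IsInterrogation.unique (hP : ¬ P.Semitrivial) {f : Fn A} {a b : A} {us us' : List A}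
    {c c' : A} (h : P.IsInterrogation f a b us c) (h' : P.IsInterrogation f a b us' c') :
    us = us' ∧ c = c' := by
  have key : ∀ {us us' : List A} {c c' : A}, P.IsInterrogation f a b us c →
      P.IsInterrogation f a b us' c' → us'.length ≤ us.length := by
    intro us us' c c' h h'
    by_contra hlt
    rw [not_le] at hlt
    have e := h.take_eq h' us.length le_rfl hlt.le
    obtain ⟨v, hv, -⟩ := h'.1 us.length hlt
    rw [← e, List.take_length] at hv
    exact hv.absurd hP h.2
  have hl : us.length = us'.length := le_antisymm (key h' h) (key h h')
  have e := h.take_eq h' us.length le_rfl hl.le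
  rw [List.take_length, hl, List.take_length] at e
  subst e
  exact ⟨rfl, h.2.unique h'.2⟩

theorem IsInterrogation.mono {f f' : Fn A} {a b a' b' : A} {us : List A} {c : A}
    (hf : f' ≤ f) (ha : a' ≤ a) (hb : b' ≤ b) (h : P.IsInterrogation f a b us c) :
    ∃ us' : List A, ∃ c' ≤ c, P.IsInterrogation f' a' b' us' c' := by
  have key : ∀ n ≤ us.length, ∃ us' : List A, List.Forall₂ (· ≤ ·) us' (us.take n) ∧
      ∀ (i : ℕ) (hi : i < us'.length),
        ∃ v : A, P.Outputs P.ff a' b' (us'.take i) v ∧ us'[i] ∈ f'.toFun v := by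
    intro n
    induction n with
    | zero => exact fun _ => ⟨[], by simp, by simp⟩
    | succ n ih =>
      intro hn
      obtain ⟨us', hus, hall⟩ := ih (by omega)
      have hlen : us'.length = n := by
        have := hus.length_eq
        rw [List.length_take] at this
        omega
      obtain ⟨v, hv, hu⟩ := h.1 n (by omega)
      obtain ⟨v', hvv, hv'⟩ := hv.mono ha hb hus
      obtain ⟨y, hy, hyu⟩ := ((hf v').trans (f.mono hvv)) _ hu
      refine ⟨us' ++ [y], ?_, ?_⟩
      · rw [List.take_succ_eq_append_getElem (by omega)]
        exact List.rel_append hus (List.Forall₂.cons hyu List.Forall₂.nil)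
      · intro i hi
        rw [List.length_append, List.length_singleton] at hi
        rcases Nat.lt_or_ge i us'.length with hi' | hi'
        · obtain ⟨w, hw, hw'⟩ := hall i hi'
          refine ⟨w, ?_, ?_⟩
          · rwa [List.take_append_of_le_length hi'.le]
          · rwa [List.getElem_append_left hi']
        · obtain rfl : i = us'.length := by omega
          refine ⟨v', ?_, ?_⟩
          · rwa [List.take_left]
          · simpa using hy
  obtain ⟨us', hus, hall⟩ := key us.length le_rfl
  rw [List.take_length] at hus
  obtain ⟨c', hc, hout⟩ := h.2.mono ha hb hus
  exact ⟨us', c', hc, hall, hout⟩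

variable (P)

open Classical in
/-- The application `a ⊙ b` of `A[f]`: it is defined and equal to `c` if and only if there is a
`b`-interrogation of `f` by `a` with output `c` (see `mem_oracleApp`). -/
noncomputable def oracleApp (f : Fn A) (a b : A) : Part A :=
  ⟨∃ c us, P.IsInterrogation f a b us c, fun h => h.choose⟩

theorem mem_oracleApp (hP : ¬ P.Semitrivial) {f : Fn A} {a b c : A} :
    c ∈ P.oracleApp f a b ↔ ∃ us, P.IsInterrogation f a b us c := by
  constructor
  · rintro ⟨h, rfl⟩
    exact h.choose_spec
  · rintro ⟨us, hus⟩
    have h : ∃ c us, P.IsInterrogation f a b us c := ⟨c, us, hus⟩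
    obtain ⟨us', hus'⟩ := h.choose_spec
    exact ⟨h, (hus'.unique hP hus).2⟩

theorem oracleApp_mono (hP : ¬ P.Semitrivial) {f f' : Fn A} {a b a' b' : A} (hf : f' ≤ f)
    (ha : a' ≤ a) (hb : b' ≤ b) : PLE (P.oracleApp f' a' b') (P.oracleApp f a b) := by
  intro c hc
  obtain ⟨us, hus⟩ := (P.mem_oracleApp hP).1 hc
  obtain ⟨us', c', hcc, hus'⟩ := hus.mono hf ha hb
  exact ⟨c', (P.mem_oracleApp hP).2 ⟨us', hus'⟩, hcc⟩

/-- The partial applicative poset `(A, ⊙, ≤)`. -/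
noncomputable def adjoinPAP (hP : ¬ P.Semitrivial) (f : Fn A) : PAP A where
  app := P.oracleApp f
  app_mono _ _ _ _ ha hb := P.oracleApp_mono hP le_rfl ha hb

/-- `A[f]`, where `A[f]^#` is the filter of `(A, ⊙, ≤)` generated by `A^#`. -/
noncomputable def adjoin (hP : ¬ P.Semitrivial) (f : Fn A) : PAS A where
  toPAP := P.adjoinPAP hP f
  eff := (P.adjoinPAP hP f).generate P.eff
  isFilter_eff := (P.adjoinPAP hP f).isFilter_generate P.isFilter_eff.nonempty

/-- The first-order function `λ a'. a ⊙ a'` in `𝓑A`, where `⊙` is the application of `A[α]`. -/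
noncomputable def oracleFn (hP : ¬ P.Semitrivial) (α : Fn A) (a : A) : Fn A where
  toFun := P.oracleApp α a
  mono _ _ h := P.oracleApp_mono hP le_rfl le_rfl h

/-- The order-preserving map `F̃ : 𝓑A → 𝓑A` with `F̃ α a ≃ F (λ a'. a ⊙ a')`, where `⊙` is the
application of `A[α]`. -/
noncomputable def tilde (hP : ¬ P.Semitrivial) (F : Fn2 A) : Fn A →o Fn A where
  toFun α :=
    { toFun := fun a => F.toFun (P.oracleFn hP α a)
      mono := fun _ _ h => F.mono fun _ => P.oracleApp_mono hP le_rfl h le_rfl }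
  monotone' _ _ h _ := F.mono fun _ => P.oracleApp_mono hP h le_rfl le_rfl

end PCA

/-! ### Partial applicative morphisms -/

section Morphisms

variable {A : Type u} {B : Type v} {C : Type w} [PartialOrder A] [PartialOrder B] [PartialOrder C]

/-- Application of downwards closed sets: `X Y` is defined if and only if `x y` is defined for all
`x ∈ X` and `y ∈ Y`, and then it is the downwards closure of the set of all these `x y`. -/
def PAP.dapp (P : PAP A) (X Y : LowerSet A) : Part (LowerSet A) :=
  ⟨∀ x ∈ X, ∀ y ∈ Y, (P.app x y).Dom,
    fun _ => lowerClosure {z | ∃ x ∈ X, ∃ y ∈ Y, z ∈ P.app x y}⟩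

/-- `a Y = ↓{a} Y` -/
def PAP.eapp (P : PAP A) (a : A) (Y : LowerSet A) : Part (LowerSet A) :=
  P.dapp (LowerSet.Iic a) Y

/-- The expression `x` is defined and a subset of `Y`. -/
def DefSub (x : Part (LowerSet A)) (Y : LowerSet A) : Prop := ∃ X ∈ x, X ≤ Y

/-- `g` is a partial applicative morphism `A ⇀ B`. -/
structure IsPAM (P : PAS A) (Q : PAS B) (g : A → LowerSet B) : Prop where
  eff : ∀ a ∈ P.eff, ∃ b ∈ g a, b ∈ Q.eff
  tracker : ∃ t ∈ Q.eff, ∀ a a' c : A, c ∈ P.app a a' →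
    DefSub ((Q.eapp t (g a)).bind fun X => Q.dapp X (g a')) (g c)
  order : ∃ r ∈ Q.eff, (∀ a : A, (Q.eapp r (g a)).Dom) ∧
    ∀ a a' : A, a ≤ a' → DefSub (Q.eapp r (g a)) (g a')

/-- `g` is total. -/
def IsTotal (g : A → LowerSet B) : Prop := ∀ a : A, ∃ b : B, b ∈ g a

/-- `g ≤ g'` for functions `A → DB`. -/
def MorLE (Q : PAS B) (g g' : A → LowerSet B) : Prop :=
  ∃ r ∈ Q.eff, ∀ a : A, DefSub (Q.eapp r (g a)) (g' a)

/-- `g ≃ g'` for functions `A → DB`. -/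
def MorEquiv (Q : PAS B) (g g' : A → LowerSet B) : Prop := MorLE Q g g' ∧ MorLE Q g' g

/-- The composition `h g`, with `h g (a) = ⋃_{b ∈ g a} h b`. -/
def morComp (h : B → LowerSet C) (g : A → LowerSet B) : A → LowerSet C :=
  fun a => ⨆ b ∈ g a, h b

/-- `g` is decidable. -/
def IsDecidable (P : PCA A) (Q : PCA B) (g : A → LowerSet B) : Prop :=
  ∃ d ∈ Q.eff, DefSub (Q.eapp d (g P.tt)) (LowerSet.Iic Q.tt) ∧
    DefSub (Q.eapp d (g P.ff)) (LowerSet.Iic Q.ff)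

/-- `b` represents `f` with respect to `g`. -/
def Represents (Q : PAS B) (g : A → LowerSet B) (b : B) (f : Fn A) : Prop :=
  ∀ a c : A, c ∈ f.toFun a → DefSub (Q.eapp b (g a)) (g c)

/-- `r` represents the second-order functional `F` with respect to `g`. -/
def Represents2 (Q : PAS B) (g : A → LowerSet B) (r : B) (F : Fn2 A) : Prop :=
  ∀ (α : Fn A) (c : A), c ∈ F.toFun α → ∀ b : B, Represents Q g b α → ∃ x ∈ Q.app r b, x ∈ g c

/-- `F` is effectively representable with respect to `g`. -/
def EffRepresentable2 (Q : PAS B) (g : A → LowerSet B) (F : Fn2 A) : Prop :=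
  ∃ r ∈ Q.eff, Represents2 Q g r F

/-- The morphism `ι_f : A → A[f]` (as a function `A → DA` it does not depend on `f`). -/
def iota (A : Type u) [PartialOrder A] : A → LowerSet A := fun a => LowerSet.Iic a

/-- A chain: a non-empty totally ordered subset. -/
def IsNonemptyChain (X : Set A) : Prop := X.Nonempty ∧ IsChain (· ≤ ·) X

/-- Every chain has a greatest lower bound. -/
def ChainComplete (A : Type u) [PartialOrder A] : Prop :=
  ∀ X : Set A, IsNonemptyChain X → ∃ m : A, IsGLB X m

/-- `g (⋀ X) = ⋂_{a ∈ X} g a` for every chain `X`. -/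
def ChainContinuous (g : A → LowerSet B) : Prop :=
  ∀ X : Set A, IsNonemptyChain X → ∀ m : A, IsGLB X m → g m = ⨅ a ∈ X, g a

end Morphisms

end RelPCA

/-! In the order of `𝓑A` the nowhere defined function is largest, and a chain of functions has a
pointwise greatest lower bound, defined wherever some member of the chain is. Zorn's lemma therefore
yields a largest fixpoint `f` of `F̃`, together with an induction principle: a property of the
nowhere defined function that is preserved by `F̃` and by infima of chains holds for `f`
(`exists_greatest_fixpoint`).

That `A[f]` is a PCA holds for any `f` and is a matter of programming. The combinator `s` has to
perform the interrogations for `a ⊙ c`, `b ⊙ c` and then `x ⊙ y` inside a single one. The program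
`run` simulates an interrogation from a list of recorded answers, passes a question on when the list
is used up, and hands the output and the unused answers to a continuation (`Interr.of_run`,
`Interr.of_oracleS₂`).

For (i), if `b` represents `α` with respect to `ι_f`, then `λ a'. b ⊙ a' ≤ α`, so `F α` is bounded
below by `F (λ a'. b ⊙ a') = F̃ f b = f b`. Asking the oracle at `b` therefore represents `F`.

For (ii), `g` itself serves as `h`. Decidability gives an effective `R` in `B` that simulates
interrogations from a representative of the oracle (`IsPAM.exists_run`). If `r` represents `F`,
recursion in `B` gives an effective `β` with `β x ≼ r (R β x)`. This one `β` represents the nowhere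
defined function, represents `F̃ α` whenever it represents `α`, and by chain-continuity represents
infima of chains of functions that it represents (`IsPAM.exists_represents`). By the induction
principle it represents `f`, and then `R β` tracks the application of `A[f]` (`IsPAM.adjoin`). -/

namespace RelPCA

/-! ### Calculus of possibly undefined applications -/

section Application

variable {A : Type u} [PartialOrder A]

/-- Application of possibly undefined elements. -/
def PAP.ap (P : PAP A) (x y : Part A) : Part A := x.bind fun a => y.bind fun b => P.app a b

@[simp]
theorem PAP.ap_some (P : PAP A) (a b : A) : P.ap (Part.some a) (Part.some b) = P.app a b := by
  simp [PAP.ap]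

theorem PAP.ap_mono (P : PAP A) {x' x y' y : Part A} (hx : PLE x' x) (hy : PLE y' y) :
    PLE (P.ap x' y') (P.ap x y) :=
  P.bind_app_mono hx hy

theorem PAP.mem_ap (P : PAP A) {x y : Part A} {c : A} :
    c ∈ P.ap x y ↔ ∃ a ∈ x, ∃ b ∈ y, c ∈ P.app a b := by
  simp [PAP.ap, Part.mem_bind_iff]

theorem PAP.app₂_eq (P : PAP A) (a b c : A) :
    P.app₂ a b c = P.ap (P.ap (Part.some a) (Part.some b)) (Part.some c) := by
  simp [PAP.app₂, PAP.ap]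

theorem PLE.some {a b : A} (h : a ≤ b) : PLE (Part.some a) (Part.some b) := by
  rintro _ hc
  rw [Part.mem_some_iff] at hc
  subst hc
  exact ⟨a, Part.mem_some a, h⟩

theorem PLE.of_mem {x : Part A} {a : A} (h : a ∈ x) : PLE x (Part.some a) := by
  rw [Part.eq_some_iff.2 h]
  exact PLE.refl _

theorem PLE.of_mem' {x : Part A} {a : A} (h : a ∈ x) : PLE (Part.some a) x := by
  rw [Part.eq_some_iff.2 h]
  exact PLE.refl _

/-- The possibly undefined element `x` is defined and belongs to `S`. -/
def Yields (x : Part A) (S : LowerSet A) : Prop := ∃ a ∈ x, a ∈ S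

/-- Because the sets are downwards closed, membership claims about programs reduce to estimates by
`≼`. -/
theorem Yields.of_le {x y : Part A} {S : LowerSet A} (hy : Yields y S) (h : PLE x y) :
    Yields x S := by
  obtain ⟨b, hb, hS⟩ := hy
  obtain ⟨a, ha, hab⟩ := h b hb
  exact ⟨a, ha, S.lower hab hS⟩

theorem Yields.some {a : A} {S : LowerSet A} (h : a ∈ S) : Yields (Part.some a) S :=
  ⟨a, Part.mem_some a, h⟩

theorem yields_Iic {x : Part A} {a : A} : Yields x (LowerSet.Iic a) ↔ PLE x (Part.some a) := by
  constructor
  · rintro ⟨b, hb, hba⟩ c hc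
    rw [Part.mem_some_iff] at hc
    subst hc
    exact ⟨b, hb, hba⟩
  · intro h
    exact h a (Part.mem_some a)

theorem PAP.IsFilter.ap_mem {P : PAP A} {S : Set A} (h : P.IsFilter S) {x y : Part A}
    (hx : ∀ a ∈ x, a ∈ S) (hy : ∀ a ∈ y, a ∈ S) : ∀ a ∈ P.ap x y, a ∈ S := by
  intro c hc
  obtain ⟨a, ha, b, hb, hc⟩ := P.mem_ap.1 hc
  exact h.app_mem (hx a ha) (hy b hb) hc

/-! ### Functions of several variables -/

/-- All constants of a term belong to `S`. -/
def Term.ConstsIn (S : Set A) : Term A → Prop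
  | .var _ => True
  | .const a => a ∈ S
  | .app t r => t.ConstsIn S ∧ r.ConstsIn S

/-- Reduces effectiveness of a program to effectiveness of the constants in its term. -/
theorem PAP.IsFilter.eval_mem {P : PAP A} {S : Set A} (h : P.IsFilter S) {ρ : ℕ → A}
    (hρ : ∀ n, ρ n ∈ S) {t : Term A} (ht : t.ConstsIn S) : ∀ a ∈ P.eval ρ t, a ∈ S := by
  induction t with
  | var n => simpa [PAP.eval] using hρ n
  | const a => simpa [PAP.eval] using (show a ∈ S from ht)
  | app t r iht ihr => exact h.ap_mem (iht ht.1) (ihr ht.2)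

namespace PCA

variable (P : PCA A)

/-- Iterated application. -/
def aps (x : Part A) (as : List A) : Part A := as.foldl (fun y a => P.ap y (Part.some a)) x

theorem aps_mono {x y : Part A} (h : PLE x y) (as : List A) : PLE (P.aps x as) (P.aps y as) := by
  induction as generalizing x y with
  | nil => exact h
  | cons a as ih => exact ih (P.ap_mono h (PLE.refl _))

theorem i_mem : P.i ∈ P.eff := by
  have h : P.i ∈ P.app₂ P.s P.k P.k := Part.get_mem _
  obtain ⟨x, hx, h⟩ := Part.mem_bind_iff.1 h
  exact P.isFilter_eff.app_mem (P.isFilter_eff.app_mem P.s_mem P.k_mem hx) P.k_mem h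

theorem tt_mem : P.tt ∈ P.eff := P.k_mem

theorem ff_mem : P.ff ∈ P.eff :=
  P.isFilter_eff.app_mem P.k_mem P.i_mem (Part.get_mem (P.k_dom P.i))

theorem constsIn_abs {n : ℕ} {t : Term A} (ht : t.ConstsIn P.eff) :
    (P.abs n t).ConstsIn P.eff := by
  induction t with
  | var m =>
    by_cases h : m = n
    · simpa [abs, h, Term.ConstsIn] using P.i_mem
    · simpa [abs, h, Term.ConstsIn] using P.k_mem
  | const a => exact ⟨P.k_mem, ht⟩
  | app t r iht ihr => exact ⟨⟨P.s_mem, iht ht.1⟩, ihr ht.2⟩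

/-- The term `λ* m, …, m + n - 1. t`. -/
noncomputable def absFrom (m : ℕ) : ℕ → Term A → Term A
  | 0, t => t
  | n + 1, t => P.abs m (absFrom (m + 1) n t)

theorem constsIn_absFrom (m n : ℕ) {t : Term A} (ht : t.ConstsIn P.eff) :
    (P.absFrom m n t).ConstsIn P.eff := by
  induction n generalizing m with
  | zero => exact ht
  | succ n ih => exact P.constsIn_abs (ih (m + 1))

/-- Induction on the arguments, each step being `abs_app`. The `i`-th argument is bound to the
variable `m + i`; the default `ρ j` leaves variables beyond the list untouched, so that partial
application is covered too. -/
theorem absFrom_app (m : ℕ) (ρ : ℕ → A) (t : Term A) (n : ℕ) (as : List A) (h : as.length ≤ n) :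
    PLE (P.aps (P.eval ρ (P.absFrom m n t)) as)
      (P.eval (fun j => if j < m then ρ j else as.getD (j - m) (ρ j))
        (P.absFrom (m + as.length) (n - as.length) t)) := by
  induction as generalizing m ρ n with
  | nil => simpa [aps] using PLE.refl _
  | cons a as ih =>
    obtain ⟨n, rfl⟩ : ∃ k, n = k + 1 := ⟨n - 1, by simp at h; omega⟩
    have h1 := P.abs_app m ρ (P.absFrom (m + 1) n t) a
    have h2 : PLE (P.ap (P.eval ρ (P.absFrom m (n + 1) t)) (Part.some a))
        (P.eval (Function.update ρ m a) (P.absFrom (m + 1) n t)) := by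
      simpa [PAP.ap, absFrom] using h1
    refine (P.aps_mono h2 as).trans ?_
    have h3 := ih (m + 1) (Function.update ρ m a) n (by simpa using h)
    convert h3 using 2
    · funext j
      rcases lt_trichotomy j m with hj | rfl | hj
      · simp [hj, Nat.lt_succ_of_lt hj, hj.ne]
      · simp
      · rw [if_neg (by omega), if_neg (by omega), Function.update_of_ne hj.ne']
        obtain ⟨k, rfl⟩ := Nat.exists_eq_add_of_lt hj
        rw [show m + k + 1 - m = k + 1 by omega, show m + k + 1 - (m + 1) = k by omega]
        rfl
    · rw [List.length_cons]
      congr 1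
      · omega
      · omega

/-- The element `λ* 0, …, n. t`. -/
noncomputable def lamN (n : ℕ) (t : Term A) : A := P.lam 0 (P.absFrom 1 n t)

theorem some_lamN (n : ℕ) (t : Term A) :
    Part.some (P.lamN n t) = P.eval (fun _ => P.k) (P.absFrom 0 (n + 1) t) :=
  Part.some_get _

theorem lamN_mem (n : ℕ) {t : Term A} (ht : t.ConstsIn P.eff) : P.lamN n t ∈ P.eff := by
  refine P.isFilter_eff.eval_mem (fun _ => P.k_mem) (P.constsIn_absFrom 0 (n + 1) ht) _ ?_
  rw [← P.some_lamN]
  exact Part.mem_some _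

/-- The variables are `0, …, n`, whence `n + 1` arguments. The default `P.k` is the value that `lam`
gives to free variables. -/
theorem lamN_app (n : ℕ) (t : Term A) (as : List A) (h : as.length = n + 1) :
    PLE (P.aps (Part.some (P.lamN n t)) as) (P.eval (fun j => as.getD j P.k) t) := by
  rw [P.some_lamN]
  have := P.absFrom_app 0 (fun _ => P.k) t (n + 1) as h.le
  rw [h, Nat.sub_self] at this
  simpa [absFrom] using this

/-- At least one abstraction is left, and abstractions always denote. -/
theorem lamN_dom (n : ℕ) (t : Term A) (as : List A) (h : as.length ≤ n) :
    (P.aps (Part.some (P.lamN n t)) as).Dom := by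
  rw [P.some_lamN]
  refine (P.absFrom_app 0 (fun _ => P.k) t (n + 1) as (by omega)).dom ?_
  rw [show n + 1 - as.length = (n - as.length) + 1 by omega]
  exact P.abs_dom _ _ _

/-! ### Fixed points -/

/-- `λ* w e x. e (w w e) x` -/
noncomputable def fixAux : A :=
  P.lamN 2 (.app (.app (.var 1) (.app (.app (.var 0) (.var 0)) (.var 1))) (.var 2))

/-- A strict fixed point of `e`. -/
noncomputable def fix (e : A) : A :=
  (P.aps (Part.some P.fixAux) [P.fixAux, e]).get (P.lamN_dom _ _ _ (by simp))

theorem some_fix (e : A) : Part.some (P.fix e) = P.aps (Part.some P.fixAux) [P.fixAux, e] :=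
  Part.some_get _

theorem fix_mem {e : A} (he : e ∈ P.eff) : P.fix e ∈ P.eff := by
  have h : P.fixAux ∈ P.eff := P.lamN_mem _ (by simp [Term.ConstsIn])
  have h' := P.isFilter_eff.ap_mem (P.isFilter_eff.ap_mem (x := Part.some P.fixAux)
    (y := Part.some P.fixAux) (by simpa using h) (by simpa using h)) (y := Part.some e)
    (by simpa using he)
  exact h' _ (Part.get_mem _)

/-- With `w = fixAux`, the fixed point is `w w e`. It waits for a third argument before unfolding,
which is why it is always defined. -/
theorem fix_app (e x : A) : PLE (P.ap (Part.some (P.fix e)) (Part.some x))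
    (P.ap (P.ap (Part.some e) (Part.some (P.fix e))) (Part.some x)) := by
  rw [P.some_fix]
  exact P.lamN_app 2 (.app (.app (.var 1) (.app (.app (.var 0) (.var 0)) (.var 1))) (.var 2))
    [P.fixAux, e, x] rfl

/-- The recursive function `λ* 1, …, n. t`, where the variable `0` stands for the function
itself. -/
noncomputable def recN (n : ℕ) (t : Term A) : A := P.fix (P.lamN n t)

theorem recN_mem (n : ℕ) {t : Term A} (ht : t.ConstsIn P.eff) : P.recN n t ∈ P.eff :=
  P.fix_mem (P.lamN_mem n ht)

/-- The fixed point unfolds only when it receives an argument, hence `n ≠ 0`. -/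
theorem recN_app (n : ℕ) (t : Term A) (as : List A) (h : as.length = n) (hn : n ≠ 0) :
    PLE (P.aps (Part.some (P.recN n t)) as)
      (P.eval (fun j => (P.recN n t :: as).getD j P.k) t) := by
  refine PLE.trans ?_ (P.lamN_app n t (P.recN n t :: as) (by simp [h]))
  cases as with
  | nil => simp at h; omega
  | cons a as => exact P.aps_mono (P.fix_app _ a) as

/-! ### Case distinctions -/

/-- If `q` is `⊤`, then `t`, and if `q` is `⊥`, then `r`. The variable `100` must not occur in `t`
and `r`. -/
noncomputable def cond (q t r : Term A) : Term A :=
  .app (.app (.app q (P.abs 100 t)) (P.abs 100 r)) (.const P.i)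

variable {P}

theorem constsIn_cond {q t r : Term A} (hq : q.ConstsIn P.eff) (ht : t.ConstsIn P.eff)
    (hr : r.ConstsIn P.eff) : (P.cond q t r).ConstsIn P.eff :=
  ⟨⟨⟨hq, P.constsIn_abs ht⟩, P.constsIn_abs hr⟩, P.i_mem⟩

variable (P)

theorem tt_app (a b : A) : PLE (P.ap (P.ap (Part.some P.tt) (Part.some a)) (Part.some b))
    (Part.some a) := by
  rw [← P.app₂_eq, ← yields_Iic]
  exact P.k_app a b

theorem i_ap (a : A) : PLE (P.ap (Part.some P.i) (Part.some a)) (Part.some a) := by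
  rw [← yields_Iic, P.ap_some]
  exact P.i_app a

theorem ff_app (a b : A) : PLE (P.ap (P.ap (Part.some P.ff) (Part.some a)) (Part.some b))
    (Part.some b) := by
  have h : PLE (P.ap (Part.some P.ff) (Part.some a)) (Part.some P.i) := by
    rw [show Part.some P.ff = P.ap (Part.some P.k) (Part.some P.i) by
      rw [P.ap_some]; exact Part.some_get _]
    exact P.tt_app P.i a
  exact (P.ap_mono h (PLE.refl _)).trans (P.i_ap b)

variable {P}

/-- Both branches are frozen under a dummy abstraction and hence defined; only the selected one is
released by the argument `i`. The other branch may diverge. -/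
theorem cond_tt {ρ : ℕ → A} {q t r : Term A} (hq : PLE (P.eval ρ q) (Part.some P.tt)) :
    PLE (P.eval ρ (P.cond q t r)) (P.eval (Function.update ρ 100 P.i) t) := by
  obtain ⟨a, ha⟩ := Part.dom_iff_mem.1 (P.abs_dom 100 ρ t)
  obtain ⟨b, hb⟩ := Part.dom_iff_mem.1 (P.abs_dom 100 ρ r)
  have h1 := P.abs_app 100 ρ t P.i
  have h2 : PLE (P.ap (P.ap (P.eval ρ q) (P.eval ρ (P.abs 100 t))) (P.eval ρ (P.abs 100 r)))
      (P.eval ρ (P.abs 100 t)) := by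
    rw [Part.eq_some_iff.2 ha, Part.eq_some_iff.2 hb]
    exact (P.ap_mono (P.ap_mono hq (PLE.refl _)) (PLE.refl _)).trans (P.tt_app a b)
  refine (P.ap_mono h2 (PLE.refl (Part.some P.i))).trans ?_
  simpa [PAP.ap] using h1

theorem cond_ff {ρ : ℕ → A} {q t r : Term A} (hq : PLE (P.eval ρ q) (Part.some P.ff)) :
    PLE (P.eval ρ (P.cond q t r)) (P.eval (Function.update ρ 100 P.i) r) := by
  obtain ⟨a, ha⟩ := Part.dom_iff_mem.1 (P.abs_dom 100 ρ t)
  obtain ⟨b, hb⟩ := Part.dom_iff_mem.1 (P.abs_dom 100 ρ r)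
  have h1 := P.abs_app 100 ρ r P.i
  have h2 : PLE (P.ap (P.ap (P.eval ρ q) (P.eval ρ (P.abs 100 t))) (P.eval ρ (P.abs 100 r)))
      (P.eval ρ (P.abs 100 r)) := by
    rw [Part.eq_some_iff.2 ha, Part.eq_some_iff.2 hb]
    exact (P.ap_mono (P.ap_mono hq (PLE.refl _)) (PLE.refl _)).trans (P.ff_app a b)
  refine (P.ap_mono h2 (PLE.refl (Part.some P.i))).trans ?_
  simpa [PAP.ap] using h1

/-! ### Pairs and sequences -/

variable (P)

theorem constsIn_pairTerm : (Term.app (.app (.var 2) (.var 0)) (.var 1) : Term A).ConstsIn P.eff :=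
  ⟨⟨trivial, trivial⟩, trivial⟩

theorem p_mem : P.p ∈ P.eff := P.lamN_mem 2 P.constsIn_pairTerm

theorem p₀_mem : P.p₀ ∈ P.eff := P.lamN_mem 0 ⟨trivial, P.tt_mem⟩

theorem p₁_mem : P.p₁ ∈ P.eff := P.lamN_mem 0 ⟨trivial, P.ff_mem⟩

theorem some_pair (a b : A) :
    Part.some (P.pair a b) = P.ap (P.ap (Part.some P.p) (Part.some a)) (Part.some b) := by
  rw [← P.app₂_eq]
  exact Part.some_get _

theorem pair_app (a b c : A) : PLE (P.ap (Part.some (P.pair a b)) (Part.some c))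
    (P.ap (P.ap (Part.some c) (Part.some a)) (Part.some b)) := by
  rw [P.some_pair]
  exact P.lamN_app 2 (Term.app (.app (.var 2) (.var 0)) (.var 1)) [a, b, c] rfl

theorem p₀_app (a : A) : PLE (P.ap (Part.some P.p₀) (Part.some a))
    (P.ap (Part.some a) (Part.some P.tt)) :=
  P.lamN_app 0 (.app (.var 0) (.const P.tt)) [a] rfl

theorem p₁_app (a : A) : PLE (P.ap (Part.some P.p₁) (Part.some a))
    (P.ap (Part.some a) (Part.some P.ff)) :=
  P.lamN_app 0 (.app (.var 0) (.const P.ff)) [a] rfl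

theorem p₀_pair (a b : A) :
    PLE (P.ap (Part.some P.p₀) (Part.some (P.pair a b))) (Part.some a) :=
  ((P.p₀_app _).trans (P.pair_app _ _ _)).trans (P.tt_app a b)

theorem p₁_pair (a b : A) :
    PLE (P.ap (Part.some P.p₁) (Part.some (P.pair a b))) (Part.some b) :=
  ((P.p₁_app _).trans (P.pair_app _ _ _)).trans (P.ff_app a b)

/-- Since `0` is coded by `i` and `n + 1` by a pair with first entry `⊥`, the combinator `p₀` is a
test for zero. -/
theorem p₀_i : PLE (P.ap (Part.some P.p₀) (Part.some P.i)) (Part.some P.tt) :=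
  (P.p₀_app _).trans (P.i_ap _)

/-- `p a₀ (p a₁ (⋯ (p aₙ₋₁ z) ⋯))` -/
noncomputable def tupleAppend (l : List A) (z : A) : A := l.foldr P.pair z

theorem tupleAppend_i (l : List A) : P.tupleAppend l P.i = P.tuple l := by
  induction l with
  | nil => rfl
  | cons a l ih => exact congrArg (P.pair a) ih

/-- Tuples nest to the right, so a new last entry goes in at the innermost place. With that place
kept as a parameter, appending is a single pairing. -/
theorem tupleAppend_concat (l : List A) (u z : A) :
    P.tupleAppend (l ++ [u]) z = P.tupleAppend l (P.pair u z) := by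
  simp [tupleAppend]

/-! ### Interrogations -/

/-- Inductive form of `IsInterrogation`: after the answers `us`, the interrogation of `f` by `a` on
the input `b` can be continued so that the final output is `c`. -/
inductive Interr (f : Fn A) (a b : A) : List A → A → Prop
  | done {us : List A} {c : A} (h : P.Outputs P.tt a b us c) : Interr f a b us c
  | ask {us : List A} {v u c : A} (h : P.Outputs P.ff a b us v) (hu : u ∈ f.toFun v)
    (hr : Interr f a b (us ++ [u]) c) : Interr f a b us c

variable {P}

theorem Interr.exists_isInterrogation {f : Fn A} {a b c : A} {us : List A}
    (h : P.Interr f a b us c)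
    (hus : ∀ (i : ℕ) (hi : i < us.length),
      ∃ v : A, P.Outputs P.ff a b (us.take i) v ∧ us[i] ∈ f.toFun v) :
    ∃ us' : List A, P.IsInterrogation f a b us' c := by
  induction h with
  | done h => exact ⟨_, hus, h⟩
  | @ask us v u c h hu hr ih =>
    refine ih fun i hi => ?_
    rw [List.length_append, List.length_singleton] at hi
    rcases Nat.lt_or_ge i us.length with hi' | hi'
    · obtain ⟨w, hw, hw'⟩ := hus i hi'
      refine ⟨w, ?_, ?_⟩
      · rwa [List.take_append_of_le_length hi'.le]
      · rwa [List.getElem_append_left hi']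
    · obtain rfl : i = us.length := by omega
      refine ⟨v, ?_, ?_⟩
      · rwa [List.take_left]
      · simpa using hu

theorem IsInterrogation.interr {f : Fn A} {a b c : A} {us : List A}
    (h : P.IsInterrogation f a b us c) : P.Interr f a b [] c := by
  -- Here `n` counts the answers still to come, so the induction runs backwards from the complete
  -- sequence.
  have key : ∀ n ≤ us.length, P.Interr f a b (us.take (us.length - n)) c := by
    intro n
    induction n with
    | zero => exact fun _ => .done (by simpa using h.2)
    | succ n ih =>
      intro hn
      obtain ⟨v, hv, hu⟩ := h.1 (us.length - (n + 1)) (by omega)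
      refine .ask hv hu ?_
      have := ih (by omega)
      rwa [show us.length - n = us.length - (n + 1) + 1 by omega,
        List.take_succ_eq_append_getElem (by omega)] at this
  simpa using key us.length le_rfl

theorem mem_oracleApp_iff (hP : ¬ P.Semitrivial) {f : Fn A} {a b c : A} :
    c ∈ P.oracleApp f a b ↔ P.Interr f a b [] c := by
  rw [P.mem_oracleApp hP]
  exact ⟨fun ⟨_, h⟩ => h.interr, fun h => h.exists_isInterrogation (by simp)⟩

/-- The result `x` of a computation says that the output is `v` (if `t = ⊤`) or that the question
`v` is asked (if `t = ⊥`). -/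
theorem outputs_of_le {t a b v : A} {us : List A}
    (h : PLE (P.ap (Part.some a) (Part.some (P.code (b :: us)))) (Part.some (P.pair t v))) :
    ∃ v' ≤ v, P.Outputs t a b us v' := by
  obtain ⟨e, he, hev⟩ := h _ (Part.mem_some _)
  rw [P.ap_some] at he
  have h0 := (P.ap_mono (PLE.refl (Part.some P.p₀)) (PLE.some hev)).trans (P.p₀_pair t v)
  have h1 := (P.ap_mono (PLE.refl (Part.some P.p₁)) (PLE.some hev)).trans (P.p₁_pair t v)
  rw [P.ap_some, ← yields_Iic] at h0
  obtain ⟨v', hv', hv⟩ := h1 _ (Part.mem_some _)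
  rw [P.ap_some] at hv'
  exact ⟨v', hv, e, he, h0, hv'⟩

end PCA

end Application

end RelPCA

namespace RelPCA

local infixl:70 " ◦ " => Term.app

namespace PCA

/-! ### Programming with coded sequences in `A[f]` -/

section Adjoin

variable {A : Type u} [PartialOrder A] (P : PCA A)

local infixl:70 " ⬝ " => PAP.ap P.toPAP

local instance coePart : Coe A (Part A) := ⟨Part.some⟩

theorem num_mem (n : ℕ) : P.num n ∈ P.eff := by
  induction n with
  | zero => exact P.i_mem
  | succ n ih =>
    have h := P.isFilter_eff.ap_mem (P.isFilter_eff.ap_mem (x := Part.some P.p)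
      (y := Part.some P.ff) (by simpa using P.p_mem) (by simpa using P.ff_mem))
      (y := Part.some (P.num n)) (by simpa using ih)
    rw [← P.some_pair] at h
    exact h _ (Part.mem_some _)

variable {P} in
theorem ap_le_of_pair₀ {x : Part A} {a b : A} (h : PLE x (Part.some (P.pair a b))) :
    PLE ((P.p₀ : Part A) ⬝ x) a :=
  (P.ap_mono (PLE.refl _) h).trans (P.p₀_pair a b)

variable {P} in
theorem ap_le_of_pair₁ {x : Part A} {a b : A} (h : PLE x (Part.some (P.pair a b))) :
    PLE ((P.p₁ : Part A) ⬝ x) b :=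
  (P.ap_mono (PLE.refl _) h).trans (P.p₁_pair a b)

variable {P} in
theorem pair_le {x y : Part A} {a b : A} (hx : PLE x (Part.some a)) (hy : PLE y (Part.some b)) :
    PLE ((P.p : Part A) ⬝ x ⬝ y) (P.pair a b) := by
  rw [P.some_pair]
  exact P.ap_mono (P.ap_mono (PLE.refl _) hx) hy

/-- The first entry of a coded sequence. -/
noncomputable def headT (t : Term A) : Term A := .const P.p₀ ◦ (.const P.p₁ ◦ t)

/-- The length of the tail of a coded sequence. -/
noncomputable def restLengthT (t : Term A) : Term A := .const P.p₁ ◦ (.const P.p₀ ◦ t)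

/-- The tuple of the entries of the tail of a coded sequence. -/
noncomputable def restTupleT (t : Term A) : Term A := .const P.p₁ ◦ (.const P.p₁ ◦ t)

/-- `p ⊤ t`, which makes `t` the output of an oracle computation. -/
noncomputable def retT (t : Term A) : Term A := .const P.p ◦ .const P.tt ◦ t

/-- `p ⊥ t`, which makes `t` a question to the oracle. -/
noncomputable def askT (t : Term A) : Term A := .const P.p ◦ .const P.ff ◦ t

variable {P} in
theorem eval_headT {ρ : ℕ → A} {t : Term A} {b : A} {us : List A}
    (h : PLE (P.eval ρ t) (P.code (b :: us))) : PLE (P.eval ρ (P.headT t)) b :=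
  ap_le_of_pair₀ (ap_le_of_pair₁ h)

variable {P} in
theorem eval_restLengthT {ρ : ℕ → A} {t : Term A} {b : A} {us : List A}
    (h : PLE (P.eval ρ t) (P.code (b :: us))) :
    PLE (P.eval ρ (P.restLengthT t)) (P.num us.length) :=
  ap_le_of_pair₁ (ap_le_of_pair₀ h)

variable {P} in
theorem eval_restTupleT {ρ : ℕ → A} {t : Term A} {b : A} {us : List A}
    (h : PLE (P.eval ρ t) (P.code (b :: us))) :
    PLE (P.eval ρ (P.restTupleT t)) (P.tuple us) :=
  ap_le_of_pair₁ (ap_le_of_pair₁ h)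

variable {P} in
theorem eval_retT {ρ : ℕ → A} {t : Term A} {b : A} (h : PLE (P.eval ρ t) b) :
    PLE (P.eval ρ (P.retT t)) (P.pair P.tt b) :=
  pair_le (PLE.refl _) h

variable {P} in
theorem eval_askT {ρ : ℕ → A} {t : Term A} {b : A} (h : PLE (P.eval ρ t) b) :
    PLE (P.eval ρ (P.askT t)) (P.pair P.ff b) :=
  pair_le (PLE.refl _) h

variable {P} in
theorem constsIn_headT {t : Term A} (h : t.ConstsIn P.eff) : (P.headT t).ConstsIn P.eff :=
  ⟨P.p₀_mem, P.p₁_mem, h⟩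

variable {P} in
theorem constsIn_restLengthT {t : Term A} (h : t.ConstsIn P.eff) :
    (P.restLengthT t).ConstsIn P.eff :=
  ⟨P.p₁_mem, P.p₀_mem, h⟩

variable {P} in
theorem constsIn_restTupleT {t : Term A} (h : t.ConstsIn P.eff) :
    (P.restTupleT t).ConstsIn P.eff :=
  ⟨P.p₁_mem, P.p₁_mem, h⟩

variable {P} in
theorem constsIn_retT {t : Term A} (h : t.ConstsIn P.eff) : (P.retT t).ConstsIn P.eff :=
  ⟨⟨P.p_mem, P.tt_mem⟩, h⟩

variable {P} in
theorem constsIn_askT {t : Term A} (h : t.ConstsIn P.eff) : (P.askT t).ConstsIn P.eff :=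
  ⟨⟨P.p_mem, P.ff_mem⟩, h⟩

variable {P} in
theorem oracleApp_of_ret (hP : ¬ P.Semitrivial) (f : Fn A) {e b c : A}
    (h : PLE ((e : Part A) ⬝ (P.code [b] : Part A)) (P.pair P.tt c)) :
    ∃ c' ∈ P.oracleApp f e b, c' ≤ c := by
  obtain ⟨c', hc, ho⟩ := outputs_of_le h
  exact ⟨c', (mem_oracleApp_iff hP).2 (.done ho), hc⟩

variable {P} in
theorem Outputs.ap_le {t a b v : A} {us : List A} (h : P.Outputs t a b us v) {x : Part A}
    (hx : PLE x (P.code (b :: us))) :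
    PLE ((P.p₀ : Part A) ⬝ ((a : Part A) ⬝ x)) t ∧
      PLE ((P.p₁ : Part A) ⬝ ((a : Part A) ⬝ x)) v := by
  obtain ⟨e, he, h0, hv⟩ := h
  have h1 : PLE ((a : Part A) ⬝ x) e := by
    refine (P.ap_mono (PLE.refl _) hx).trans ?_
    rw [P.ap_some]
    exact .of_mem he
  constructor
  · refine (P.ap_mono (PLE.refl _) h1).trans ?_
    rwa [P.ap_some, ← yields_Iic]
  · refine (P.ap_mono (PLE.refl _) h1).trans ?_
    rw [P.ap_some]
    exact .of_mem hv

/-! ### Simulation of an interrogation inside another one -/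

/-- `λ* φ u z. φ (p u z)` -/
noncomputable def snoc : A := P.lamN 2 (.var 0 ◦ (.const P.p ◦ .var 1 ◦ .var 2))

theorem snoc_mem : P.snoc ∈ P.eff := P.lamN_mem 2 ⟨trivial, ⟨P.p_mem, trivial⟩, trivial⟩

theorem snoc_dom (φ u : A) : ((P.snoc : Part A) ⬝ (φ : Part A) ⬝ (u : Part A)).Dom :=
  P.lamN_dom 2 _ [φ, u] le_rfl

theorem snoc_app (φ u z : A) : PLE ((P.snoc : Part A) ⬝ (φ : Part A) ⬝ (u : Part A) ⬝ (z : Part A))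
    ((φ : Part A) ⬝ (P.pair u z : Part A)) := by
  rw [P.some_pair]
  exact P.lamN_app 2 (.var 0 ◦ (.const P.p ◦ .var 1 ◦ .var 2)) [φ, u, z] rfl

/-- The term `x (p n (φ i))`. -/
noncomputable def queryT : Term A :=
  .var 1 ◦ (.const P.p ◦ .var 2 ◦ (.var 3 ◦ .const P.i))

theorem constsIn_queryT : P.queryT.ConstsIn P.eff :=
  ⟨trivial, ⟨P.p_mem, trivial⟩, trivial, P.i_mem⟩

/-- The body of `run`. -/
noncomputable def runT : Term A :=
  -- The variables `0, …, 6` stand for `run`, `x`, `n`, `φ`, `κ`, `m`, `t`. The outer test asks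
  -- whether `x` has finished, the inner one whether `m` is zero.
  P.cond (.const P.p₀ ◦ P.queryT) (.var 4 ◦ (.const P.p₁ ◦ P.queryT) ◦ .var 5 ◦ .var 6)
    (P.cond (.const P.p₀ ◦ .var 5) (P.askT (.const P.p₁ ◦ P.queryT))
      (.var 0 ◦ .var 1 ◦ (.const P.p ◦ .const P.ff ◦ .var 2) ◦
        (.const P.snoc ◦ .var 3 ◦ (.const P.p₀ ◦ .var 6)) ◦ .var 4 ◦ (.const P.p₁ ◦ .var 5) ◦
        (.const P.p₁ ◦ .var 6)))

/-- The simulation `run x n φ κ m t` of the interrogation by `x` whose present state is given by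
the length `n` and the function `φ` that prepends the entries. Answers are taken from the tuple `t`
of length `m`; when these are used up, the question is passed on. The output and the remaining
answers are passed to the continuation `κ`. -/
noncomputable def run : A := P.recN 6 P.runT

theorem run_mem : P.run ∈ P.eff := by
  refine P.recN_mem 6 (constsIn_cond ⟨P.p₀_mem, P.constsIn_queryT⟩
    ⟨⟨⟨trivial, P.p₁_mem, P.constsIn_queryT⟩, trivial⟩, trivial⟩
    (constsIn_cond ⟨P.p₀_mem, trivial⟩ (constsIn_askT ⟨P.p₁_mem, P.constsIn_queryT⟩) ?_))
  have := P.p_mem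
  have := P.ff_mem
  have := P.snoc_mem
  have := P.p₀_mem
  have := P.p₁_mem
  simp_all [Term.ConstsIn]

theorem run_app (x n φ κ m t : A) :
    PLE ((P.run : Part A) ⬝ (x : Part A) ⬝ (n : Part A) ⬝ (φ : Part A) ⬝ (κ : Part A) ⬝
      (m : Part A) ⬝ (t : Part A))
      (P.eval (fun j => [P.run, x, n, φ, κ, m, t].getD j P.k) P.runT) :=
  P.recN_app 6 P.runT [x, n, φ, κ, m, t] rfl (by decide)

/-- The pair of `n` and `φ` describes the sequence `l`. -/
def IsState (n φ : A) (l : List A) : Prop :=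
  n ≤ P.num l.length ∧ ∀ z : A, PLE ((φ : Part A) ⬝ (z : Part A)) (P.tupleAppend l z)

variable {P}

theorem IsState.code_le {n φ : A} {l : List A} (h : P.IsState n φ l) :
    PLE ((P.p : Part A) ⬝ (n : Part A) ⬝ ((φ : Part A) ⬝ (P.i : Part A))) (P.code l) := by
  refine pair_le (PLE.some h.1) ?_
  rw [← P.tupleAppend_i]
  exact h.2 _

/-- The stored entry may be smaller than the intended one, as the simulated question may be smaller
than the original and so may its answer. -/
theorem IsState.concat {n φ u φ' : A} {l : List A} (h : P.IsState n φ l) {u' : A} (hu : u ≤ u')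
    (hφ : (φ' : Part A) = (P.snoc : Part A) ⬝ (φ : Part A) ⬝ (u : Part A)) :
    P.IsState (P.pair P.ff n) φ' (l ++ [u']) := by
  constructor
  · rw [List.length_append]
    exact P.pair_mono le_rfl h.1
  · intro z
    rw [hφ, P.tupleAppend_concat]
    refine (P.snoc_app φ u z).trans (PLE.trans ?_ (h.2 _))
    exact P.ap_mono (PLE.refl _) (PLE.some (P.pair_mono hu le_rfl))

theorem isState_singleton {y φ : A} (hφ : (φ : Part A) = (P.p : Part A) ⬝ (y : Part A)) :
    P.IsState (P.num 1) φ [y] := by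
  refine ⟨le_rfl, fun z => ?_⟩
  rw [hφ, ← P.some_pair]
  exact PLE.refl _

theorem run_done {a b v n φ : A} {us : List A} (h : P.Outputs P.tt a b us v)
    (hs : P.IsState n φ (b :: us)) (κ m t : A) :
    PLE ((P.run : Part A) ⬝ (a : Part A) ⬝ (n : Part A) ⬝ (φ : Part A) ⬝ (κ : Part A) ⬝
      (m : Part A) ⬝ (t : Part A)) ((κ : Part A) ⬝ (v : Part A) ⬝ (m : Part A) ⬝ (t : Part A)) := by
  obtain ⟨h0, h1⟩ := h.ap_le hs.code_le
  refine (P.run_app a n φ κ m t).trans ((cond_tt ?_).trans ?_)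
  · exact h0
  exact P.ap_mono (P.ap_mono (P.ap_mono (PLE.refl _) h1) (PLE.refl _)) (PLE.refl _)

theorem run_ask {a b v n φ : A} {us : List A} (h : P.Outputs P.ff a b us v)
    (hs : P.IsState n φ (b :: us)) (κ t : A) :
    PLE ((P.run : Part A) ⬝ (a : Part A) ⬝ (n : Part A) ⬝ (φ : Part A) ⬝ (κ : Part A) ⬝
      (P.num 0 : Part A) ⬝ (t : Part A)) (P.pair P.ff v) := by
  obtain ⟨h0, h1⟩ := h.ap_le hs.code_le
  refine (P.run_app a n φ κ (P.num 0) t).trans ((cond_ff ?_).trans ((cond_tt ?_).trans ?_))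
  · exact h0
  · exact P.p₀_i
  · exact eval_askT h1

theorem run_answer {a b v n φ : A} {us : List A} (h : P.Outputs P.ff a b us v)
    (hs : P.IsState n φ (b :: us)) (κ u : A) (rest : List A) :
    PLE ((P.run : Part A) ⬝ (a : Part A) ⬝ (n : Part A) ⬝ (φ : Part A) ⬝ (κ : Part A) ⬝
      (P.num (u :: rest).length : Part A) ⬝ (P.tuple (u :: rest) : Part A))
      ((P.run : Part A) ⬝ (a : Part A) ⬝ (P.pair P.ff n : Part A) ⬝
        ((P.snoc : Part A) ⬝ (φ : Part A) ⬝ (u : Part A)) ⬝ (κ : Part A) ⬝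
      (P.num rest.length : Part A) ⬝ (P.tuple rest : Part A)) := by
  obtain ⟨h0, h1⟩ := h.ap_le hs.code_le
  refine (P.run_app a n φ κ _ _).trans ((cond_ff ?_).trans ((cond_ff ?_).trans ?_))
  · exact h0
  · exact P.p₀_pair _ _
  · refine P.ap_mono (P.ap_mono (P.ap_mono (P.ap_mono (P.ap_mono (PLE.refl _) ?_) ?_)
      (PLE.refl _)) ?_) ?_
    · exact pair_le (PLE.refl _) (PLE.refl _)
    · exact P.ap_mono (PLE.refl _) (P.p₀_pair _ _)
    · exact P.p₁_pair _ _
    · exact P.p₁_pair _ _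

/-- If `w` simulates an interrogation by `a`, it suffices to consider the continuation. -/
theorem Interr.of_run {f : Fn A} {a y x : A} {us : List A} (h : P.Interr f a y us x)
    {w c z κ : A}
    (hκ : ∀ L : List A, (∀ rest : List A, PLE ((w : Part A) ⬝ (P.code (c :: (L ++ rest)) : Part A))
      ((κ : Part A) ⬝ (x : Part A) ⬝ (P.num rest.length : Part A) ⬝ (P.tuple rest : Part A))) →
      ∃ z' ≤ z, P.Interr f w c L z')
    {n φ : A} {L : List A} (hs : P.IsState n φ (y :: us))
    (hw : ∀ rest : List A, PLE ((w : Part A) ⬝ (P.code (c :: (L ++ rest)) : Part A))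
      ((P.run : Part A) ⬝ (a : Part A) ⬝ (n : Part A) ⬝ (φ : Part A) ⬝ (κ : Part A) ⬝
        (P.num rest.length : Part A) ⬝ (P.tuple rest : Part A))) :
    ∃ z' ≤ z, P.Interr f w c L z' := by
  induction h generalizing n φ L with
  | done h => exact hκ L fun rest => (hw rest).trans (run_done h hs _ _ _)
  | @ask us v u x h hu hr ih =>
    -- When exactly the answers `L` are available, the simulation runs dry here, so `w` asks a
    -- question below `v`.
    obtain ⟨v', hvv, hv'⟩ := outputs_of_le (by simpa using (hw []).trans (run_ask h hs κ _))
    obtain ⟨u', hu', huu⟩ := f.mono hvv _ hu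
    obtain ⟨φ', hφ⟩ := Part.dom_iff_mem.1 (P.snoc_dom φ u')
    rw [← Part.eq_some_iff] at hφ
    -- Each call of `w` restarts from the whole sequence of answers. The hypothesis for every `rest`
    -- thus allows one answer to move from `rest` to `L`.
    obtain ⟨z', hz, hz'⟩ := ih hκ (L := L ++ [u']) (hs.concat huu hφ.symm) fun rest => by
      have := (hw (u' :: rest)).trans (run_answer h hs κ u' rest)
      rw [hφ] at this
      simpa using this
    exact ⟨z', hz, .ask hv' hu' hz'⟩

/-- An interrogation starts with the one-entry sequence `[y]`, whose state is `1` together with `p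
y`. -/
theorem Interr.of_run_init (hP : ¬ P.Semitrivial) {f : Fn A} {a y x : A}
    (h : x ∈ P.oracleApp f a y) {w c z κ : A} {κ' : Part A} (hκ' : κ' = Part.some κ)
    (hκ : ∀ L : List A, (∀ rest : List A, PLE ((w : Part A) ⬝ (P.code (c :: (L ++ rest)) : Part A))
      (κ' ⬝ (x : Part A) ⬝ (P.num rest.length : Part A) ⬝ (P.tuple rest : Part A))) →
      ∃ z' ≤ z, P.Interr f w c L z')
    {L : List A}
    (hw : ∀ rest : List A, PLE ((w : Part A) ⬝ (P.code (c :: (L ++ rest)) : Part A))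
      ((P.run : Part A) ⬝ (a : Part A) ⬝ (P.num 1 : Part A) ⬝ ((P.p : Part A) ⬝ (y : Part A)) ⬝
        κ' ⬝ (P.num rest.length : Part A) ⬝ (P.tuple rest : Part A))) :
    ∃ z' ≤ z, P.Interr f w c L z' := by
  subst hκ'
  obtain ⟨φ, hφ⟩ := Part.dom_iff_mem.1 (P.lamN_dom 2 _ [y] (by simp) :
    ((P.p : Part A) ⬝ (y : Part A)).Dom)
  have hφ' : (P.p : Part A) ⬝ (y : Part A) = φ := Part.eq_some_iff.2 hφ
  refine Interr.of_run ((mem_oracleApp_iff hP).1 h) hκ (isState_singleton hφ'.symm) ?_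
  rwa [hφ'] at hw

/-! ### The combinators of `A[f]` -/

variable (P)

/-- The combinator `k` of `A[f]`. -/
noncomputable def oracleK : A :=
  P.lamN 0 (P.retT (.const (P.lamN 1 (P.retT (P.headT (.var 0)))) ◦ .var 0))

theorem oracleK_mem : P.oracleK ∈ P.eff :=
  P.lamN_mem 0 (constsIn_retT
    ⟨P.lamN_mem 1 (constsIn_retT (constsIn_headT trivial)), trivial⟩)

theorem oracleK_app (hP : ¬ P.Semitrivial) (f : Fn A) (a b : A) :
    ∃ x ∈ P.oracleApp f P.oracleK a, ∃ c ∈ P.oracleApp f x b, c ≤ a := by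
  obtain ⟨y, hy⟩ := Part.dom_iff_mem.1
    (P.lamN_dom 1 (P.retT (P.headT (.var 0))) [P.code [a]] le_rfl)
  have h1 : PLE ((P.oracleK : Part A) ⬝ (P.code [a] : Part A)) (P.pair P.tt y) :=
    (P.lamN_app 0 _ [P.code [a]] rfl).trans (eval_retT (.of_mem hy))
  obtain ⟨x, hx, hxy⟩ := oracleApp_of_ret hP f h1
  refine ⟨x, hx, oracleApp_of_ret hP f ?_⟩
  refine (P.ap_mono (PLE.some hxy) (PLE.refl _)).trans ?_
  rw [← Part.eq_some_iff.2 hy]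
  exact (P.lamN_app 1 (P.retT (P.headT (.var 0))) [P.code [a], P.code [b]] rfl).trans
    (eval_retT (eval_headT (us := []) (PLE.refl _)))

/-- `λ* z m t. p ⊤ z` -/
noncomputable def contRet : A := P.lamN 2 (P.retT (.var 0))

/-- `λ* x y m t. run x 1 (p y) contRet m t` -/
noncomputable def contApp : A :=
  P.lamN 3 (.const P.run ◦ .var 0 ◦ .const (P.num 1) ◦ (.const P.p ◦ .var 1) ◦ .const P.contRet ◦
    .var 2 ◦ .var 3)

/-- `λ* b c x m t. run b 1 (p c) (contApp x) m t` -/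
noncomputable def contArg : A :=
  P.lamN 4 (.const P.run ◦ .var 0 ◦ .const (P.num 1) ◦ (.const P.p ◦ .var 1) ◦
    (.const P.contApp ◦ .var 2) ◦ .var 3 ◦ .var 4)

/-- The element representing `c ↦ (a ⊙ c) ⊙ (b ⊙ c)`, with parameters `a` and `b`. -/
noncomputable def oracleS₂ : A :=
  P.lamN 2 (.const P.run ◦ .var 0 ◦ .const (P.num 1) ◦ (.const P.p ◦ P.headT (.var 2)) ◦
    (.const P.contArg ◦ .var 1 ◦ P.headT (.var 2)) ◦ P.restLengthT (.var 2) ◦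
    P.restTupleT (.var 2))

/-- The combinator `s` of `A[f]`. -/
noncomputable def oracleS : A :=
  P.lamN 0 (P.retT (.const (P.lamN 1 (P.retT
    (.const P.oracleS₂ ◦ .var 0 ◦ P.headT (.var 1)))) ◦ P.headT (.var 0)))

theorem oracleS_mem : P.oracleS ∈ P.eff := by
  have h0 := P.run_mem
  have h1 := P.p_mem
  have h2 := P.num_mem 1
  have h3 : P.contRet ∈ P.eff := P.lamN_mem 2 (constsIn_retT trivial)
  have h4 : P.contApp ∈ P.eff := P.lamN_mem 3 (by simp [Term.ConstsIn, h0, h1, h2, h3])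
  have h5 : P.contArg ∈ P.eff := P.lamN_mem 4 (by simp [Term.ConstsIn, h0, h1, h2, h4])
  have h6 : (P.headT (.var 2)).ConstsIn P.eff := constsIn_headT trivial
  have h7 : (P.restLengthT (.var 2)).ConstsIn P.eff := constsIn_restLengthT trivial
  have h8 : (P.restTupleT (.var 2)).ConstsIn P.eff := constsIn_restTupleT trivial
  have h9 : P.oracleS₂ ∈ P.eff :=
    P.lamN_mem 2 (by simp [Term.ConstsIn, h0, h1, h2, h5, h6, h7, h8])
  exact P.lamN_mem 0 (constsIn_retT ⟨P.lamN_mem 1 (constsIn_retT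
    ⟨⟨h9, trivial⟩, constsIn_headT trivial⟩), constsIn_headT trivial⟩)

theorem oracleS₂_app (a b l : A) {c : A} {rest : List A} (hl : l = P.code (c :: rest)) :
    PLE ((P.oracleS₂ : Part A) ⬝ (a : Part A) ⬝ (b : Part A) ⬝ (l : Part A))
      ((P.run : Part A) ⬝ (a : Part A) ⬝ (P.num 1 : Part A) ⬝ ((P.p : Part A) ⬝ (c : Part A)) ⬝
        ((P.contArg : Part A) ⬝ (b : Part A) ⬝ (c : Part A)) ⬝ (P.num rest.length : Part A) ⬝
        (P.tuple rest : Part A)) := by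
  subst hl
  refine (P.lamN_app 2 _ [a, b, P.code (c :: rest)] rfl).trans ?_
  have hv : ∀ ρ : ℕ → A, ρ 2 = P.code (c :: rest) →
      PLE (P.eval ρ (.var 2)) (P.code (c :: rest)) := fun ρ h => by
    rw [← h]
    exact PLE.refl _
  refine P.ap_mono (P.ap_mono (P.ap_mono (P.ap_mono (PLE.refl _) ?_) ?_) ?_) ?_
  · exact P.ap_mono (PLE.refl _) (eval_headT (hv _ rfl))
  · exact P.ap_mono (PLE.refl _) (eval_headT (hv _ rfl))
  · exact eval_restLengthT (hv _ rfl)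
  · exact eval_restTupleT (hv _ rfl)

variable {P} in
-- The three interrogations are chained through the continuations `contArg`, `contApp` and
-- `contRet`. Each resumes with the answers that its predecessor left over, and the lists `L` record
-- what has been consumed so far.
theorem Interr.of_oracleS₂ (hP : ¬ P.Semitrivial) {f : Fn A} {a b c x y z w : A}
    (hx : x ∈ P.oracleApp f a c) (hy : y ∈ P.oracleApp f b c) (hz : z ∈ P.oracleApp f x y)
    (hw : ∀ l : A, PLE ((w : Part A) ⬝ (l : Part A))
      ((P.oracleS₂ : Part A) ⬝ (a : Part A) ⬝ (b : Part A) ⬝ (l : Part A))) :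
    ∃ z' ≤ z, P.Interr f w c [] z' := by
  obtain ⟨κ₁, h₁⟩ := Part.dom_iff_mem.1 (P.lamN_dom 4 _ [b, c] (by simp) :
    ((P.contArg : Part A) ⬝ (b : Part A) ⬝ (c : Part A)).Dom)
  obtain ⟨κ₂, h₂⟩ := Part.dom_iff_mem.1 (P.lamN_dom 3 _ [x] (by simp) :
    ((P.contApp : Part A) ⬝ (x : Part A)).Dom)
  refine Interr.of_run_init hP hx (Part.eq_some_iff.2 h₁) ?_
    (fun rest => (hw _).trans (P.oracleS₂_app a b _ rfl))
  intro L hL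
  refine Interr.of_run_init hP hy (Part.eq_some_iff.2 h₂) ?_
    (fun rest => (hL rest).trans (P.lamN_app 4 _ [b, c, x, _, _] rfl))
  intro L hL
  refine Interr.of_run_init hP hz rfl ?_
    (fun rest => (hL rest).trans (P.lamN_app 3 _ [x, y, _, _] rfl))
  intro L hL
  have h : PLE _ (Part.some (P.pair P.tt z)) :=
    (hL []).trans ((P.lamN_app 2 _ [z, _, _] rfl).trans (eval_retT (PLE.refl _)))
  rw [List.append_nil] at h
  obtain ⟨z', hz', ho⟩ := outputs_of_le h
  exact ⟨z', hz', .done ho⟩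

/-- The first two arguments are absorbed without questions to the oracle, so definedness does not
depend on `f`. -/
theorem oracleS_app (hP : ¬ P.Semitrivial) (f : Fn A) (a b : A) :
    ∃ x ∈ P.oracleApp f P.oracleS a, ∃ w ∈ P.oracleApp f x b, ∀ l : A,
      PLE ((w : Part A) ⬝ (l : Part A))
        ((P.oracleS₂ : Part A) ⬝ (a : Part A) ⬝ (b : Part A) ⬝ (l : Part A)) := by
  set t : Term A := P.retT (.const P.oracleS₂ ◦ .var 0 ◦ P.headT (.var 1))
  obtain ⟨y, hy⟩ := Part.dom_iff_mem.1 (P.lamN_dom 1 t [a] le_rfl)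
  have h1 : PLE ((P.oracleS : Part A) ⬝ (P.code [a] : Part A)) (P.pair P.tt y) := by
    refine (P.lamN_app 0 _ [P.code [a]] rfl).trans (eval_retT (PLE.trans ?_ (.of_mem hy)))
    exact P.ap_mono (PLE.refl _) (eval_headT (us := []) (PLE.refl _))
  obtain ⟨x, hx, hxy⟩ := oracleApp_of_ret hP f h1
  obtain ⟨v, hv⟩ := Part.dom_iff_mem.1 (P.lamN_dom 2 _ [a, b] le_rfl :
    ((P.oracleS₂ : Part A) ⬝ (a : Part A) ⬝ (b : Part A)).Dom)
  have h2 : PLE ((x : Part A) ⬝ (P.code [b] : Part A)) (P.pair P.tt v) := by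
    refine (P.ap_mono (PLE.some hxy) (PLE.refl _)).trans ?_
    rw [← Part.eq_some_iff.2 hy]
    refine (P.lamN_app 1 t [a, P.code [b]] rfl).trans (eval_retT (PLE.trans ?_ (.of_mem hv)))
    exact P.ap_mono (PLE.refl _) (eval_headT (us := []) (PLE.refl _))
  obtain ⟨w, hw, hwv⟩ := oracleApp_of_ret hP f h2
  refine ⟨x, hx, w, hw, fun l => ?_⟩
  refine PLE.trans ?_ (P.ap_mono (PLE.of_mem' hv) (PLE.refl _))
  exact P.ap_mono (PLE.some hwv) (PLE.refl _)

theorem subset_adjoin_eff (hP : ¬ P.Semitrivial) (f : Fn A) : P.eff ⊆ (P.adjoin hP f).eff :=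
  fun _ ha _ _ hF => hF ha

/-- The partial combinatory algebra `A[f]`. -/
noncomputable def adjoinPCA (hP : ¬ P.Semitrivial) (f : Fn A) : PCA A where
  toPAS := P.adjoin hP f
  k := P.oracleK
  s := P.oracleS
  k_mem := P.subset_adjoin_eff hP f P.oracleK_mem
  s_mem := P.subset_adjoin_eff hP f P.oracleS_mem
  k_app a b := by
    obtain ⟨x, hx, c, hc, h⟩ := P.oracleK_app hP f a b
    exact ⟨c, Part.mem_bind_iff.2 ⟨x, hx, hc⟩, h⟩
  s_dom a b := by
    obtain ⟨x, hx, w, hw, -⟩ := P.oracleS_app hP f a b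
    exact Part.dom_iff_mem.2 ⟨w, Part.mem_bind_iff.2 ⟨x, hx, hw⟩⟩
  s_app a b c := by
    intro z hz
    obtain ⟨x, hx, hz⟩ := Part.mem_bind_iff.1 hz
    obtain ⟨y, hy, hz⟩ := Part.mem_bind_iff.1 hz
    obtain ⟨v, hv, w, hw, h⟩ := P.oracleS_app hP f a b
    obtain ⟨z', hzz, hz'⟩ := Interr.of_oracleS₂ hP hx hy hz h
    exact ⟨z', Part.mem_bind_iff.2 ⟨w, Part.mem_bind_iff.2 ⟨v, hv, hw⟩,
      (mem_oracleApp_iff hP).2 hz'⟩, hzz⟩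

/-! ### Effective elements for `ι_f` and for access to the oracle -/

/-- `λ* l. p ⊤ (λ* m. p ⊤ (a b))`, where `a` and `b` are the first entries of `l` and `m`. -/
noncomputable def oracleOfApp : A :=
  P.lamN 0 (P.retT (.const (P.lamN 1 (P.retT (.var 0 ◦ P.headT (.var 1)))) ◦ P.headT (.var 0)))

theorem oracleOfApp_mem : P.oracleOfApp ∈ P.eff :=
  P.lamN_mem 0 (constsIn_retT ⟨P.lamN_mem 1 (constsIn_retT ⟨trivial, constsIn_headT trivial⟩),
    constsIn_headT trivial⟩)

theorem oracleOfApp_app (hP : ¬ P.Semitrivial) (f : Fn A) (a : A) :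
    ∃ x ∈ P.oracleApp f P.oracleOfApp a, ∀ b c : A, c ∈ P.app a b →
      ∃ c' ∈ P.oracleApp f x b, c' ≤ c := by
  set t : Term A := P.retT (.var 0 ◦ P.headT (.var 1))
  obtain ⟨y, hy⟩ := Part.dom_iff_mem.1 (P.lamN_dom 1 t [a] le_rfl)
  have h1 : PLE ((P.oracleOfApp : Part A) ⬝ (P.code [a] : Part A)) (P.pair P.tt y) := by
    refine (P.lamN_app 0 _ [P.code [a]] rfl).trans (eval_retT (PLE.trans ?_ (.of_mem hy)))
    exact P.ap_mono (PLE.refl _) (eval_headT (us := []) (PLE.refl _))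
  obtain ⟨x, hx, hxy⟩ := oracleApp_of_ret hP f h1
  refine ⟨x, hx, fun b c hc => oracleApp_of_ret hP f ?_⟩
  refine (P.ap_mono (PLE.some hxy) (PLE.refl _)).trans ?_
  rw [← Part.eq_some_iff.2 hy]
  refine (P.lamN_app 1 t [a, P.code [b]] rfl).trans (eval_retT (PLE.trans ?_ (.of_mem hc)))
  rw [← P.ap_some]
  exact P.ap_mono (PLE.refl _) (eval_headT (us := []) (PLE.refl _))

/-- `λ* l. p ⊤ a`, where `a` is the first entry of `l`. -/
noncomputable def oracleId : A := P.lamN 0 (P.retT (P.headT (.var 0)))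

theorem oracleId_mem : P.oracleId ∈ P.eff := P.lamN_mem 0 (constsIn_retT (constsIn_headT trivial))

theorem oracleId_app (hP : ¬ P.Semitrivial) (f : Fn A) (a : A) :
    ∃ c ∈ P.oracleApp f P.oracleId a, c ≤ a :=
  oracleApp_of_ret hP f ((P.lamN_app 0 _ [P.code [a]] rfl).trans
    (eval_retT (eval_headT (us := []) (PLE.refl _))))

/-- The element that asks for the value of the oracle at its argument. -/
noncomputable def oracleAsk : A :=
  P.lamN 0 (P.cond (.const P.p₀ ◦ P.restLengthT (.var 0)) (P.askT (P.headT (.var 0)))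
    (P.retT (.const P.p₀ ◦ P.restTupleT (.var 0))))

theorem oracleAsk_mem : P.oracleAsk ∈ P.eff :=
  P.lamN_mem 0 (constsIn_cond ⟨P.p₀_mem, constsIn_restLengthT trivial⟩
    (constsIn_askT (constsIn_headT trivial))
    (constsIn_retT ⟨P.p₀_mem, constsIn_restTupleT trivial⟩))

/-- The interrogation has one question: with no answer recorded the argument is asked, and with one
recorded it is returned. -/
theorem oracleAsk_app (hP : ¬ P.Semitrivial) (f : Fn A) {a c : A} (hc : c ∈ f.toFun a) :
    ∃ c' ∈ P.oracleApp f P.oracleAsk a, c' ≤ c := by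
  have hv : ∀ (l : A) (ρ : ℕ → A), ρ 0 = l → PLE (P.eval ρ (.var 0)) l := fun l ρ h => by
    rw [← h]
    exact PLE.refl _
  have h1 : PLE ((P.oracleAsk : Part A) ⬝ (P.code [a] : Part A)) (P.pair P.ff a) := by
    refine (P.lamN_app 0 _ [P.code [a]] rfl).trans ((cond_tt ?_).trans ?_)
    · exact (P.ap_mono (PLE.refl _) (eval_restLengthT (us := []) (hv _ _ rfl))).trans P.p₀_i
    · exact eval_askT (eval_headT (us := []) (hv _ _ rfl))
  obtain ⟨v, hva, hv'⟩ := outputs_of_le h1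
  obtain ⟨u, hu, huc⟩ := f.mono hva _ hc
  have h2 : PLE ((P.oracleAsk : Part A) ⬝ (P.code [a, u] : Part A)) (P.pair P.tt u) := by
    refine (P.lamN_app 0 _ [P.code [a, u]] rfl).trans ((cond_ff ?_).trans ?_)
    · exact (P.ap_mono (PLE.refl _) (eval_restLengthT (us := [u]) (hv _ _ rfl))).trans
        (P.p₀_pair _ _)
    · exact eval_retT ((P.ap_mono (PLE.refl _) (eval_restTupleT (us := [u]) (hv _ _ rfl))).trans
        (P.p₀_pair _ _))
  obtain ⟨c', hc', ho⟩ := outputs_of_le h2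
  exact ⟨c', (mem_oracleApp_iff hP).2 (.ask hv' hu (.done ho)), hc'.trans huc⟩

/-- A common lower bound of the booleans of `A[f]`, applied in `A[f]` to the booleans of `A`, would
produce a common lower bound of the latter. -/
theorem adjoinPCA_not_semitrivial (hP : ¬ P.Semitrivial) (f : Fn A) :
    ¬ (P.adjoinPCA hP f).Semitrivial := by
  rintro ⟨x, hx, hx'⟩
  set Q := P.adjoinPCA hP f
  have h1 := (Q.ap_mono (Q.ap_mono (PLE.some hx) (PLE.refl _)) (PLE.refl _)).trans
    (Q.tt_app P.tt P.ff)
  have h2 := (Q.ap_mono (Q.ap_mono (PLE.some hx') (PLE.refl _)) (PLE.refl _)).trans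
    (Q.ff_app P.tt P.ff)
  obtain ⟨y, hy, hyt⟩ := h1 _ (Part.mem_some _)
  obtain ⟨y', hy', hyf⟩ := h2 _ (Part.mem_some _)
  obtain rfl := Part.mem_unique hy hy'
  exact hP ⟨y, hyt, hyf⟩

end Adjoin

end PCA

end RelPCA

namespace RelPCA

/-! ### Largest fixpoints -/

section Fixpoint

variable {A : Type u} [PartialOrder A]

/-- In a poset with a largest element in which every chain has a greatest lower bound, every
order-preserving map has a largest fixpoint, and this satisfies an induction principle. -/
theorem exists_greatest_fixpoint {X : Type u} [PartialOrder X] (hX : ChainComplete X) {top : X}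
    (htop : IsTop top) (T : X →o X) :
    ∃ x : X, IsGreatest {y | T y = y} x ∧ ∀ φ : X → Prop, φ top → (∀ y, φ y → φ (T y)) →
      (∀ C : Set X, IsNonemptyChain C → ∀ m, IsGLB C m → (∀ y ∈ C, φ y) → φ m) → φ x := by
  have key : ∀ φ : X → Prop, φ top → (∀ y, φ y → φ (T y)) →
      (∀ C : Set X, IsNonemptyChain C → ∀ m, IsGLB C m → (∀ y ∈ C, φ y) → φ m) →
      ∃ x : X, IsGreatest {y | T y = y} x ∧ φ x := by
    intro φ h0 h1 h2
    -- A minimal element of this set is sought. The set is closed under `T` and infima of chains, so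
    -- minimality turns `T x ≤ x` into equality.
    let S : Set X := {x | T x ≤ x ∧ (∀ y, T y = y → y ≤ x) ∧ φ x}
    obtain ⟨x, hx⟩ := @zorn_le₀ Xᵒᵈ _ S fun C hCS hC => by
      rcases C.eq_empty_or_nonempty with rfl | hne
      · exact ⟨top, ⟨htop _, fun y _ => htop y, h0⟩, by simp⟩
      · have hC' : @IsNonemptyChain X _ C := ⟨hne, hC.symm⟩
        obtain ⟨m, hm⟩ := hX C hC'
        refine ⟨m, ⟨hm.2 fun c hc => ?_, fun y hy => hm.2 fun c hc => (hCS hc).2.1 y hy,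
          h2 C hC' m hm fun c hc => (hCS hc).2.2⟩, fun c hc => hm.1 hc⟩
        exact (T.monotone (hm.1 hc)).trans (hCS hc).1
    have hxS : x ∈ S := hx.1
    have hTS : T x ∈ S :=
      ⟨T.monotone hxS.1, fun y hy => hy ▸ T.monotone (hxS.2.1 y hy), h1 _ hxS.2.2⟩
    exact ⟨x, ⟨le_antisymm hxS.1 (hx.2 hTS hxS.1), fun y hy => hxS.2.1 y hy⟩, hxS.2.2⟩
  obtain ⟨x, hx, -⟩ := key (fun _ => True) trivial (fun _ _ => trivial) fun _ _ _ _ _ => trivial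
  -- The element from `key` depends on `φ`, but a greatest fixpoint is unique, so one `x` serves
  -- every `φ`.
  refine ⟨x, hx, fun φ h0 h1 h2 => ?_⟩
  obtain ⟨x', hx', hφ⟩ := key φ h0 h1 h2
  rwa [hx.unique hx']

/-- The function that is nowhere defined. -/
def Fn.empty (A : Type u) [PartialOrder A] : Fn A where
  toFun _ := Part.none
  mono _ _ _ _ hb := (Part.notMem_none _ hb).elim

theorem Fn.isTop_empty : IsTop (Fn.empty A) := fun _ _ _ hb => (Part.notMem_none _ hb).elim

/-- The set of values at `a` of the functions in `C`. -/
def Fn.values (C : Set (Fn A)) (a : A) : Set A := {c | ∃ α ∈ C, c ∈ α.toFun a}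

theorem Fn.isChain_values {C : Set (Fn A)} (hC : IsChain (· ≤ ·) C) (a : A) :
    IsChain (· ≤ ·) (Fn.values C a) := by
  have key : ∀ {α β : Fn A} {c d : A}, α ≤ β → c ∈ α.toFun a → d ∈ β.toFun a → c ≤ d := by
    intro α β c d h hc hd
    obtain ⟨c', hc', hcd⟩ := h a d hd
    rwa [Part.mem_unique hc hc']
  rintro c ⟨α, hα, hc⟩ d ⟨β, hβ, hd⟩ -
  rcases hC.total hα hβ with h | h
  · exact .inl (key h hc hd)
  · exact .inr (key h hd hc)

theorem Fn.exists_isGLB_values (hA : ChainComplete A) {C : Set (Fn A)} (hC : IsChain (· ≤ ·) C)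
    {a : A} (h : (Fn.values C a).Nonempty) : ∃ m, IsGLB (Fn.values C a) m :=
  hA _ ⟨h, Fn.isChain_values hC a⟩

/-- The pointwise greatest lower bound of a chain of functions. -/
noncomputable def Fn.chainInf (hA : ChainComplete A) {C : Set (Fn A)} (hC : IsChain (· ≤ ·) C) :
    Fn A where
  toFun a := ⟨(Fn.values C a).Nonempty, fun h => (Fn.exists_isGLB_values hA hC h).choose⟩
  mono := by
    rintro a b hab _ ⟨⟨d, α, hα, hd⟩, rfl⟩
    obtain ⟨c, hc, hcd⟩ := α.mono hab d hd
    refine ⟨_, ⟨⟨c, α, hα, hc⟩, rfl⟩, ?_⟩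
    refine (Fn.exists_isGLB_values hA hC ⟨d, α, hα, hd⟩).choose_spec.2 ?_
    rintro e ⟨β, hβ, he⟩
    obtain ⟨e', he', hee⟩ := β.mono hab e he
    exact ((Fn.exists_isGLB_values hA hC ⟨c, α, hα, hc⟩).choose_spec.1 ⟨β, hβ, he'⟩).trans hee

theorem Fn.mem_chainInf (hA : ChainComplete A) {C : Set (Fn A)} (hC : IsChain (· ≤ ·) C)
    {a c : A} (hc : c ∈ (Fn.chainInf hA hC).toFun a) :
    (Fn.values C a).Nonempty ∧ IsGLB (Fn.values C a) c := by
  obtain ⟨h, rfl⟩ := hc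
  exact ⟨h, (Fn.exists_isGLB_values hA hC h).choose_spec⟩

/-- Smaller functions have larger domains, so the domain of the infimum is the union of the domains.
-/
theorem Fn.isGLB_chainInf (hA : ChainComplete A) {C : Set (Fn A)} (hC : IsChain (· ≤ ·) C) :
    IsGLB C (Fn.chainInf hA hC) := by
  constructor
  · intro α hα a c hc
    have h : (Fn.values C a).Nonempty := ⟨c, α, hα, hc⟩
    exact ⟨_, ⟨h, rfl⟩, (Fn.exists_isGLB_values hA hC h).choose_spec.1 ⟨α, hα, hc⟩⟩
  · intro β hβ a c hc
    obtain ⟨⟨d, α, hα, hd⟩, hglb⟩ := Fn.mem_chainInf hA hC hc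
    obtain ⟨e, he, -⟩ := hβ hα a d hd
    refine ⟨e, he, hglb.2 ?_⟩
    rintro d' ⟨α', hα', hd'⟩
    obtain ⟨e', he', hed⟩ := hβ hα' a d' hd'
    rwa [Part.mem_unique he he']

theorem Fn.chainComplete (hA : ChainComplete A) : ChainComplete (Fn A) :=
  fun _ hC => ⟨_, Fn.isGLB_chainInf hA hC.2⟩

/-- Uniqueness of infima makes every infimum of a chain pointwise, which is the form that
chain-continuity can be applied to. -/
theorem Fn.isGLB_values (hA : ChainComplete A) {C : Set (Fn A)} (hC : IsChain (· ≤ ·) C)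
    {m : Fn A} (hm : IsGLB C m) {a c : A} (hc : c ∈ m.toFun a) :
    (Fn.values C a).Nonempty ∧ IsGLB (Fn.values C a) c := by
  rw [hm.unique (Fn.isGLB_chainInf hA hC)] at hc
  exact Fn.mem_chainInf hA hC hc

end Fixpoint

/-! ### Applicative morphisms -/

section Morphisms

variable {A : Type u} {B : Type v} [PartialOrder A] [PartialOrder B]

/-- Monotonicity of application takes care of the elements below `b`, so conditions on sets become
conditions on elements. -/
theorem defSub_eapp (Q : PAP B) {b : B} {Y Z : LowerSet B} :
    DefSub (Q.eapp b Y) Z ↔ ∀ y ∈ Y, Yields (Q.app b y) Z := by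
  constructor
  · rintro ⟨_, ⟨h, rfl⟩, hle⟩ y hy
    refine ⟨_, Part.get_mem (h b le_rfl y hy), hle ?_⟩
    exact subset_lowerClosure ⟨b, le_rfl, y, hy, Part.get_mem _⟩
  · intro h
    have h' : ∀ b' ≤ b, ∀ y ∈ Y, Yields (Q.app b' y) Z := fun b' hb y hy =>
      (h y hy).of_le (Q.app_mono hb le_rfl)
    refine ⟨_, ⟨fun b' hb y hy => ?_, rfl⟩, ?_⟩
    · obtain ⟨z, hz, -⟩ := h' b' hb y hy
      exact Part.dom_iff_mem.2 ⟨z, hz⟩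
    · rintro _ ⟨z, ⟨b', hb, y, hy, hz⟩, hle⟩
      obtain ⟨z', hz', hZ⟩ := h' b' hb y hy
      rw [Part.mem_unique hz hz'] at hle
      exact Z.lower hle hZ

theorem defSub_eapp_bind (Q : PAP B) {t : B} {X Y Z : LowerSet B} :
    DefSub ((Q.eapp t X).bind fun W => Q.dapp W Y) Z ↔
      ∀ x ∈ X, ∃ w ∈ Q.app t x, ∀ y ∈ Y, Yields (Q.app w y) Z := by
  constructor
  · rintro ⟨V, hV, hle⟩ x hx
    obtain ⟨_, ⟨h, rfl⟩, h', rfl⟩ := Part.mem_bind_iff.1 hV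
    have hw := subset_lowerClosure (s := {z | ∃ t' ∈ LowerSet.Iic t, ∃ x ∈ X, z ∈ Q.app t' x})
      ⟨t, le_rfl, x, hx, Part.get_mem (h t le_rfl x hx)⟩
    refine ⟨_, Part.get_mem (h t le_rfl x hx), fun y hy => ?_⟩
    refine ⟨_, Part.get_mem (h' _ hw y hy), hle ?_⟩
    exact subset_lowerClosure ⟨_, hw, y, hy, Part.get_mem _⟩
  · intro h
    have h1 : ∀ t' ≤ t, ∀ x ∈ X, ∃ w ∈ Q.app t' x, ∀ y ∈ Y, Yields (Q.app w y) Z := by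
      intro t' ht x hx
      obtain ⟨w, hw, hwy⟩ := h x hx
      obtain ⟨w', hw', hle⟩ := Q.app_mono ht (le_refl x) w hw
      exact ⟨w', hw', fun y hy => (hwy y hy).of_le (Q.app_mono hle le_rfl)⟩
    have h2 : ∀ w ∈ lowerClosure {z | ∃ t' ∈ LowerSet.Iic t, ∃ x ∈ X, z ∈ Q.app t' x},
        ∀ y ∈ Y, Yields (Q.app w y) Z := by
      rintro w ⟨z, ⟨t', ht, x, hx, hz⟩, hle⟩ y hy
      obtain ⟨w', hw', hwy⟩ := h1 t' ht x hx
      rw [Part.mem_unique hz hw'] at hle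
      exact (hwy y hy).of_le (Q.app_mono hle le_rfl)
    refine ⟨_, Part.mem_bind_iff.2 ⟨_, ⟨fun t' ht x hx => ?_, rfl⟩, fun w hw y hy => ?_, rfl⟩, ?_⟩
    · obtain ⟨w, hw, -⟩ := h1 t' ht x hx
      exact Part.dom_iff_mem.2 ⟨w, hw⟩
    · obtain ⟨z, hz, -⟩ := h2 w hw y hy
      exact Part.dom_iff_mem.2 ⟨z, hz⟩
    · rintro _ ⟨z, ⟨w, hw, y, hy, hz⟩, hle⟩
      obtain ⟨z', hz', hZ⟩ := h2 w hw y hy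
      rw [Part.mem_unique hz hz'] at hle
      exact Z.lower hle hZ

theorem represents_iff (Q : PAS B) {g : A → LowerSet B} {b : B} {f : Fn A} :
    Represents Q g b f ↔
      ∀ a c : A, c ∈ f.toFun a → ∀ x ∈ g a, Yields (Q.app b x) (g c) :=
  forall₂_congr fun _ _ => imp_congr_right fun _ => defSub_eapp Q.toPAP

/-! #### The inclusion of `A` into `A[f]` -/

theorem isPAM_iota (P : PCA A) (hP : ¬ P.Semitrivial) (f : Fn A) :
    IsPAM P.toPAS (P.adjoin hP f) (iota A) where
  eff a ha := ⟨a, le_rfl, P.subset_adjoin_eff hP f ha⟩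
  tracker := by
    refine ⟨P.oracleOfApp, P.subset_adjoin_eff hP f P.oracleOfApp_mem, fun a a' c hc => ?_⟩
    rw [defSub_eapp_bind]
    intro x hx
    obtain ⟨w, hw, h⟩ := P.oracleOfApp_app hP f x
    refine ⟨w, hw, fun y hy => ?_⟩
    obtain ⟨c', hc', hle⟩ := P.app_mono (show x ≤ a from hx) (show y ≤ a' from hy) c hc
    obtain ⟨d, hd, hle'⟩ := h y c' hc'
    exact ⟨d, hd, hle'.trans hle⟩
  order := by
    have h : ∀ a a' : A, a ≤ a' →
        DefSub ((P.adjoin hP f).eapp P.oracleId (iota A a)) (iota A a') := by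
      intro a a' haa
      rw [defSub_eapp]
      intro x hx
      obtain ⟨c, hc, hcx⟩ := P.oracleId_app hP f x
      exact ⟨c, hc, hcx.trans ((show x ≤ a from hx).trans haa)⟩
    refine ⟨P.oracleId, P.subset_adjoin_eff hP f P.oracleId_mem, fun a => ?_, h⟩
    obtain ⟨X, hX, -⟩ := h a a le_rfl
    exact Part.dom_iff_mem.2 ⟨X, hX⟩

/-- A representative `b` of `α` gives `λ a'. b ⊙ a' ≤ α`, and the value of `F` at the smaller
function is `F̃ f b = f b`. Any fixpoint would do. -/
theorem effRepresentable2_iota (P : PCA A) (hP : ¬ P.Semitrivial) {F : Fn2 A} {f : Fn A}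
    (hf : P.tilde hP F f = f) : EffRepresentable2 (P.adjoin hP f) (iota A) F := by
  refine ⟨P.oracleAsk, P.subset_adjoin_eff hP f P.oracleAsk_mem, fun α c hc b hb => ?_⟩
  rw [represents_iff] at hb
  have hle : P.oracleFn hP f b ≤ α := fun a d hd => hb a d hd a (le_refl a)
  obtain ⟨c', hc', hcc⟩ := F.mono hle c hc
  have hfb : c' ∈ f.toFun b := by
    rw [← hf]
    exact hc'
  obtain ⟨x, hx, hxc⟩ := P.oracleAsk_app hP f hfb
  exact ⟨x, hx, hxc.trans hcc⟩

end Morphisms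

end RelPCA

namespace RelPCA

local infixl:70 " ◦ " => Term.app

/-! ### Extending `g` along `ι_f` -/

section Extension

variable {A : Type u} {B : Type v} [PartialOrder A] [PartialOrder B] {P : PCA A} {Q : PCA B}
  {g : A → LowerSet B}

local infixl:70 " ⬝ " => PAP.ap Q.toPAP

local instance coePart' : Coe B (Part B) := ⟨Part.some⟩

theorem Yields.ap {τ : B} {x y : Part B} {X Y Z : LowerSet B} (hx : Yields x X) (hy : Yields y Y)
    (h : ∀ a ∈ X, ∀ b ∈ Y, Yields ((τ : Part B) ⬝ (a : Part B) ⬝ (b : Part B)) Z) :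
    Yields ((τ : Part B) ⬝ x ⬝ y) Z := by
  obtain ⟨a, ha, haX⟩ := hx
  obtain ⟨b, hb, hbY⟩ := hy
  exact (h a haX b hbY).of_le (Q.ap_mono (Q.ap_mono (PLE.refl _) (.of_mem ha)) (.of_mem hb))

theorem Yields.ap_left {τ : B} {x : Part B} {X Z : LowerSet B} (hx : Yields x X)
    (h : ∀ a ∈ X, Yields (Q.app τ a) Z) : Yields ((τ : Part B) ⬝ x) Z := by
  obtain ⟨a, ha, haX⟩ := hx
  refine Yields.of_le ?_ (Q.ap_mono (PLE.refl _) (.of_mem ha))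
  rw [Q.ap_some]
  exact h a haX

/-- Application in `A`, up to enlarging the result, is tracked by an effective element. -/
theorem IsPAM.exists_tracker (hg : IsPAM P.toPAS Q.toPAS g) :
    ∃ τ ∈ Q.eff, ∀ {a b c : A} {x y : Part B}, PLE (P.app a b) (Part.some c) →
      Yields x (g a) → Yields y (g b) → Yields ((τ : Part B) ⬝ x ⬝ y) (g c) := by
  obtain ⟨t, ht, htr⟩ := hg.tracker
  obtain ⟨r, hr, -, hor⟩ := hg.order
  refine ⟨Q.lamN 1 (.const r ◦ (.const t ◦ .var 0 ◦ .var 1)),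
    Q.lamN_mem 1 ⟨hr, ⟨ht, trivial⟩, trivial⟩, fun {a b c x y} hc hx hy => ?_⟩
  refine hx.ap hy fun x hx y hy => Yields.of_le ?_ (Q.lamN_app 1 _ [x, y] rfl)
  obtain ⟨d, hd, hdc⟩ := hc _ (Part.mem_some _)
  refine Yields.ap_left (Q := Q) (X := g d) ?_ ((defSub_eapp Q.toPAP).1 (hor d c hdc))
  obtain ⟨w, hw, h⟩ := (defSub_eapp_bind Q.toPAP).1 (htr a b d hd) x hx
  refine (h y hy).of_le ?_
  rw [← Q.ap_some]
  refine Q.ap_mono ?_ (PLE.refl _)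
  exact PLE.of_mem (by rw [← Q.ap_some] at hw; exact hw)

/-- Pairing in `A` is tracked by an effective element. -/
theorem IsPAM.exists_pair (hg : IsPAM P.toPAS Q.toPAS g) :
    ∃ π ∈ Q.eff, (∀ x : B, ((π : Part B) ⬝ (x : Part B)).Dom) ∧
      ∀ {a b : A} {x y : Part B}, Yields x (g a) → Yields y (g b) →
        Yields ((π : Part B) ⬝ x ⬝ y) (g (P.pair a b)) := by
  obtain ⟨τ, hτ, htr⟩ := hg.exists_tracker
  obtain ⟨q, hq, hqe⟩ := hg.eff P.p P.p_mem
  refine ⟨Q.lamN 1 (.const τ ◦ (.const τ ◦ .const q ◦ .var 0) ◦ .var 1),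
    Q.lamN_mem 1 ⟨⟨hτ, ⟨hτ, hqe⟩, trivial⟩, trivial⟩, fun x => Q.lamN_dom 1 _ [x] le_rfl,
    fun {a b x y} hx hy => ?_⟩
  refine hx.ap hy fun x hx y hy => Yields.of_le ?_ (Q.lamN_app 1 _ [x, y] rfl)
  have hm : P.pair a b ∈ P.app₂ P.p a b := Part.get_mem _
  obtain ⟨d, hd, hm⟩ := Part.mem_bind_iff.1 hm
  exact htr (.of_mem hm) (htr (.of_mem hd) (.some hq) (.some hx)) (.some hy)

/-- Interrogations can be simulated along a decidable partial applicative morphism. -/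
theorem IsPAM.exists_run (hP : ¬ P.Semitrivial) (hg : IsPAM P.toPAS Q.toPAS g)
    (hd : IsDecidable P Q g) :
    ∃ R ∈ Q.eff, (∀ β x : B, ((R : Part B) ⬝ (β : Part B) ⬝ (x : Part B)).Dom) ∧
      ∀ (α : Fn A) (β : B), Represents Q.toPAS g β α → ∀ a b c : A, c ∈ P.oracleApp α a b →
        ∀ x ∈ g a, ∀ y ∈ g b,
          Yields ((R : Part B) ⬝ (β : Part B) ⬝ (x : Part B) ⬝ (y : Part B)) (g c) := by
  obtain ⟨τ, hτ, htr⟩ := hg.exists_tracker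
  obtain ⟨π, hπ, hπd, hpair⟩ := hg.exists_pair
  obtain ⟨d, hde, hdt, hdf⟩ := hd
  rw [defSub_eapp] at hdt hdf
  obtain ⟨q₀, hq₀, hq₀e⟩ := hg.eff P.p₀ P.p₀_mem
  obtain ⟨q₁, hq₁, hq₁e⟩ := hg.eff P.p₁ P.p₁_mem
  obtain ⟨o, ho, hoe⟩ := hg.eff P.ff P.ff_mem
  obtain ⟨j, hj, hje⟩ := hg.eff P.i P.i_mem
  obtain ⟨n₁, hn₁, hn₁e⟩ := hg.eff (P.num 1) (P.num_mem 1)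
  set tσ : Term B := .var 0 ◦ (.const π ◦ .var 1 ◦ .var 2) with htσ
  set σ : B := Q.lamN 2 tσ with hσ
  have hσe : σ ∈ Q.eff := Q.lamN_mem 2 ⟨trivial, ⟨hπ, trivial⟩, trivial⟩
  -- Variables `0, …, 4` stand for the recursive program, `β`, and realizers of `a`, of the length
  -- and of the map prepending the entries so far. The term realizes `a` applied to the coded
  -- sequence.
  set E : Term B := .const τ ◦ .var 2 ◦ (.const π ◦ .var 3 ◦ (.var 4 ◦ .const j)) with hE
  have hEe : E.ConstsIn Q.eff := ⟨⟨hτ, trivial⟩, ⟨hπ, trivial⟩, trivial, hje⟩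
  set t : Term B := Q.cond (.const d ◦ (.const τ ◦ .const q₀ ◦ E)) (.const τ ◦ .const q₁ ◦ E)
    (.var 0 ◦ .var 1 ◦ .var 2 ◦ (.const π ◦ .const o ◦ .var 3) ◦
      (.const σ ◦ .var 4 ◦ (.var 1 ◦ (.const τ ◦ .const q₁ ◦ E)))) with ht
  have hte : t.ConstsIn Q.eff := PCA.constsIn_cond ⟨hde, ⟨hτ, hq₀e⟩, hEe⟩ ⟨⟨hτ, hq₁e⟩, hEe⟩
    ⟨⟨⟨⟨trivial, trivial⟩, trivial⟩, ⟨hπ, hoe⟩, trivial⟩, ⟨hσe, trivial⟩, trivial, ⟨hτ, hq₁e⟩, hEe⟩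
  set r : B := Q.recN 4 t with hr
  have hre : r ∈ Q.eff := Q.recN_mem 4 hte
  -- No answers need to be recorded in advance here: `β` supplies them during the loop.
  have key : ∀ (α : Fn A) (β : B), Represents Q.toPAS g β α → ∀ (a b c : A) (us : List A),
      P.Interr α a b us c → ∀ x ∈ g a, ∀ n ∈ g (P.num (us.length + 1)), ∀ φ : B,
      (∀ z₀ : A, ∀ z ∈ g z₀, Yields ((φ : Part B) ⬝ (z : Part B))
        (g (P.tupleAppend (b :: us) z₀))) →
      Yields ((r : Part B) ⬝ (β : Part B) ⬝ (x : Part B) ⬝ (n : Part B) ⬝ (φ : Part B)) (g c) := by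
    intro α β hβ a b c us h
    rw [represents_iff] at hβ
    have query : ∀ {t' v : A} {us : List A}, P.Outputs t' a b us v → ∀ x ∈ g a,
        ∀ n ∈ g (P.num (us.length + 1)), ∀ φ : B,
        (∀ z₀ : A, ∀ z ∈ g z₀, Yields ((φ : Part B) ⬝ (z : Part B))
          (g (P.tupleAppend (b :: us) z₀))) → ∀ ρ : ℕ → B, ρ 2 = x → ρ 3 = n → ρ 4 = φ →
        Yields (Q.eval ρ (.const τ ◦ .const q₀ ◦ E)) (g t') ∧
          Yields (Q.eval ρ (.const τ ◦ .const q₁ ◦ E)) (g v) := by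
      rintro t' v us ⟨e, he, h0, hv⟩ x hx n hn φ hφ ρ rfl rfl rfl
      have hφj := hφ P.i j hj
      rw [P.tupleAppend_i] at hφj
      have hEy : Yields (Q.eval ρ E) (g e) :=
        htr (.of_mem he) (.some hx) (hpair (.some hn) hφj)
      exact ⟨htr (yields_Iic.1 h0) (.some hq₀) hEy, htr (.of_mem hv) (.some hq₁) hEy⟩
    induction h with
    | @done us c h =>
      intro x hx n hn φ hφ
      refine Yields.of_le ?_ (Q.recN_app 4 t [β, x, n, φ] rfl (by decide))
      obtain ⟨h0, -⟩ := query h x hx n hn φ hφ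
        (fun j => [r, β, x, n, φ].getD j Q.k) rfl rfl rfl
      refine Yields.of_le ?_ (PCA.cond_tt (yields_Iic.1 (h0.ap_left hdt)))
      exact (query h x hx n hn φ hφ _ rfl rfl rfl).2
    | @ask us v u c h hu hrec ih =>
      intro x hx n hn φ hφ
      refine Yields.of_le ?_ (Q.recN_app 4 t [β, x, n, φ] rfl (by decide))
      obtain ⟨h0, -⟩ := query h x hx n hn φ hφ
        (fun j => [r, β, x, n, φ].getD j Q.k) rfl rfl rfl
      refine Yields.of_le ?_ (PCA.cond_ff (yields_Iic.1 (h0.ap_left hdf)))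
      set ρ : ℕ → B := Function.update (fun j => [r, β, x, n, φ].getD j Q.k) 100 Q.i with hρ
      have hv := (query h x hx n hn φ hφ ρ rfl rfl rfl).2
      obtain ⟨u', hu', hug⟩ := hv.ap_left (hβ v u hu)
      obtain ⟨n', hn', hng⟩ := hpair (.some ho) (.some hn)
      obtain ⟨φ', hφ'⟩ := Part.dom_iff_mem.1 (Q.lamN_dom 2 tσ [φ, u'] le_rfl)
      have := ih x hx n' (by simpa [PCA.num] using hng) φ' fun z₀ z hz => by
        rw [← List.cons_append, P.tupleAppend_concat]
        obtain ⟨z', hz', hzg⟩ := hpair (.some hug) (.some hz)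
        refine (hφ _ z' hzg).of_le ?_
        refine (Q.ap_mono (.of_mem' hφ') (PLE.refl _)).trans ?_
        refine (Q.lamN_app 2 tσ [φ, u', z] rfl).trans ?_
        exact Q.ap_mono (PLE.refl _) (.of_mem hz')
      refine this.of_le ?_
      refine Q.ap_mono (Q.ap_mono (PLE.refl _) (.of_mem hn')) (PLE.trans ?_ (.of_mem hφ'))
      exact Q.ap_mono (PLE.refl _) (.of_mem hu')
  refine ⟨Q.lamN 2 (.const r ◦ .var 0 ◦ .var 1 ◦ .const n₁ ◦ (.const π ◦ .var 2)),
    Q.lamN_mem 2 ⟨⟨⟨⟨hre, trivial⟩, trivial⟩, hn₁e⟩, hπ, trivial⟩,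
    fun β x => Q.lamN_dom 2 _ [β, x] le_rfl, fun α β hβ a b c hc x hx y hy => ?_⟩
  refine Yields.of_le ?_ (Q.lamN_app 2 _ [β, x, y] rfl)
  obtain ⟨φ, hφ⟩ := Part.dom_iff_mem.1 (hπd y)
  refine (key α β hβ a b c [] ((PCA.mem_oracleApp_iff hP).1 hc) x hx n₁ hn₁ φ
    fun z₀ z hz => ?_).of_le (Q.ap_mono (PLE.refl _) (.of_mem hφ))
  exact (hpair (.some hy) (.some hz)).of_le (Q.ap_mono (.of_mem' hφ) (PLE.refl _))

/-- If `α` is represented by an effective element, then `g` is also a partial applicative morphism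
`A[α] ⇀ B`. -/
theorem IsPAM.adjoin (hP : ¬ P.Semitrivial) (hg : IsPAM P.toPAS Q.toPAS g)
    (hd : IsDecidable P Q g) {α : Fn A} {β : B} (hβ : β ∈ Q.eff)
    (hα : Represents Q.toPAS g β α) : IsPAM (P.adjoin hP α) Q.toPAS g := by
  obtain ⟨R, hR, hRd, hRun⟩ := hg.exists_run hP hd
  obtain ⟨t, ht⟩ := Part.dom_iff_mem.1 (Q.lamN_dom 2 (.const R ◦ .var 0 ◦ .var 1 ◦ .var 2) [β]
    (by simp))
  have hte : t ∈ Q.eff := by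
    have h := Q.lamN_mem 2 (t := .const R ◦ .var 0 ◦ .var 1 ◦ .var 2)
      ⟨⟨⟨hR, trivial⟩, trivial⟩, trivial⟩
    refine Q.isFilter_eff.ap_mem (y := (β : Part B)) ?_ ?_ t ht
    · simpa using h
    · simpa using hβ
  have happ : ∀ a b c : A, c ∈ P.oracleApp α a b → ∀ x ∈ g a, ∀ y ∈ g b,
      Yields ((t : Part B) ⬝ (x : Part B) ⬝ (y : Part B)) (g c) := by
    intro a b c hc x hx y hy
    refine (hRun α β hα a b c hc x hx y hy).of_le ?_
    refine (Q.ap_mono (Q.ap_mono (.of_mem' ht) (PLE.refl _)) (PLE.refl _)).trans ?_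
    exact Q.lamN_app 2 (.const R ◦ .var 0 ◦ .var 1 ◦ .var 2) [β, x, y] rfl
  have hdom : ∀ x : B, (Q.app t x).Dom := by
    intro x
    have h := Q.lamN_dom 2 (.const R ◦ .var 0 ◦ .var 1 ◦ .var 2) [β, x] le_rfl
    have h' : PLE ((t : Part B) ⬝ (x : Part B)) _ := Q.ap_mono (.of_mem' ht) (PLE.refl _)
    rw [← Q.ap_some]
    exact h'.dom h
  refine ⟨fun a ha => ?_, ⟨t, hte, fun a a' c hc => ?_⟩, hg.order⟩
  -- The elements of `A` with an effective realizer form a filter for the new application and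
  -- include `A^#`, hence they include the generated filter.
  · refine ha {a | ∃ b ∈ g a, b ∈ Q.eff} ⟨?_, ?_, ?_⟩ hg.eff
    · exact ⟨P.k, hg.eff _ P.k_mem⟩
    · rintro a b c ⟨x, hx, hxe⟩ ⟨y, hy, hye⟩ hc
      obtain ⟨z, hz, hzc⟩ := happ a b c hc x hx y hy
      refine ⟨z, hzc, Q.isFilter_eff.ap_mem (Q.isFilter_eff.ap_mem (x := (t : Part B))
        (y := (x : Part B)) ?_ ?_) (y := (y : Part B)) ?_ z hz⟩
      · simpa using hte
      · simpa using hxe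
      · simpa using hye
    · rintro a b hab ⟨x, hx, hxe⟩
      obtain ⟨r, hr, -, hor⟩ := hg.order
      obtain ⟨z, hz, hzb⟩ := (defSub_eapp Q.toPAP).1 (hor a b hab) x hx
      exact ⟨z, hzb, Q.isFilter_eff.app_mem hr hxe hz⟩
  · rw [defSub_eapp_bind]
    intro x hx
    obtain ⟨w, hw⟩ := Part.dom_iff_mem.1 (hdom x)
    refine ⟨w, hw, fun y hy => (happ a a' c hc x hx y hy).of_le ?_⟩
    rw [← Q.ap_some]
    refine Q.ap_mono (.of_mem' ?_) (PLE.refl _)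
    rwa [Q.ap_some]

/-- An element that represents all functions reached by iterating `F̃`. -/
theorem IsPAM.exists_represents (hP : ¬ P.Semitrivial) (hA : ChainComplete A)
    (hg : IsPAM P.toPAS Q.toPAS g) (hd : IsDecidable P Q g) (hc : ChainContinuous g) {F : Fn2 A}
    (hF : EffRepresentable2 Q.toPAS g F) :
    ∃ β ∈ Q.eff, Represents Q.toPAS g β (Fn.empty A) ∧
      (∀ α : Fn A, Represents Q.toPAS g β α → Represents Q.toPAS g β (P.tilde hP F α)) ∧
      ∀ C : Set (Fn A), IsNonemptyChain C → ∀ m, IsGLB C m →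
        (∀ α ∈ C, Represents Q.toPAS g β α) → Represents Q.toPAS g β m := by
  obtain ⟨R, hR, hRd, hRun⟩ := hg.exists_run hP hd
  obtain ⟨r, hr, hrF⟩ := hF
  -- The recursion gives `β x ≼ r (R β x)`; the choice of `β` does not depend on the function to be
  -- represented.
  refine ⟨Q.recN 1 (.const r ◦ (.const R ◦ .var 0 ◦ .var 1)),
    Q.recN_mem 1 ⟨hr, ⟨hR, trivial⟩, trivial⟩, ?_, ?_, ?_⟩
  · intro a c h
    exact (Part.notMem_none _ h).elim
  · set β := Q.recN 1 (.const r ◦ (.const R ◦ .var 0 ◦ .var 1)) with hβ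
    intro α hα
    rw [represents_iff]
    intro a c h x hx
    obtain ⟨w, hw⟩ := Part.dom_iff_mem.1 (hRd β x)
    -- Since `w = R β x` represents the argument of `F` in `F̃ α a`, applying `r` to it gives the
    -- required value.
    have hwr : Represents Q.toPAS g w (P.oracleFn hP α a) := by
      rw [represents_iff]
      intro b d hd y hy
      refine (hRun α β hα a b d hd x hx y hy).of_le ?_
      rw [← Q.ap_some]
      exact Q.ap_mono (.of_mem' hw) (PLE.refl _)
    rw [← Q.ap_some]
    refine Yields.of_le (hrF _ c h w hwr) ((Q.recN_app 1 _ [x] rfl (by decide)).trans ?_)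
    rw [← Q.ap_some]
    exact Q.ap_mono (PLE.refl _) (.of_mem hw)
  · intro C hC m hm hall
    rw [represents_iff]
    intro a c h x hx
    obtain ⟨⟨d, α, hα, hd⟩, hglb⟩ := Fn.isGLB_values hA hC.2 hm h
    obtain ⟨y, hy, -⟩ := (represents_iff _).1 (hall α hα) a d hd x hx
    -- The value `y = β x` is the same for all members of the chain. It thus lies in the
    -- intersection of the sets for their values at `a`, which chain-continuity identifies with `g
    -- c`.
    refine ⟨y, hy, ?_⟩
    have hne : (Fn.values C a).Nonempty := ⟨d, α, hα, hd⟩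
    rw [hc _ ⟨hne, Fn.isChain_values hC.2 a⟩ c hglb, LowerSet.mem_iInf₂_iff]
    rintro e ⟨α', hα', he⟩
    obtain ⟨y', hy', hye⟩ := (represents_iff _).1 (hall α' hα') a e he x hx
    rwa [Part.mem_unique hy hy']

/-- The composite at `a` is the union of `g b` over `b ≤ a`. It contains `g a`, and the order
realizer of `g` maps it back into `g a`. -/
theorem IsPAM.morEquiv_comp_iota (hg : IsPAM P.toPAS Q.toPAS g) :
    MorEquiv Q.toPAS (morComp g (iota A)) g := by
  constructor
  · obtain ⟨r, hr, -, hor⟩ := hg.order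
    refine ⟨r, hr, fun a => (defSub_eapp Q.toPAP).2 fun x hx => ?_⟩
    obtain ⟨b, hb, hx⟩ := LowerSet.mem_iSup₂_iff.1 hx
    exact (defSub_eapp Q.toPAP).1 (hor b a hb) x hx
  · refine ⟨Q.i, Q.i_mem, fun a => (defSub_eapp Q.toPAP).2 fun x hx => ?_⟩
    obtain ⟨y, hy, hyx⟩ := Q.i_app x
    exact ⟨y, hy, LowerSet.mem_iSup₂_iff.2 ⟨a, le_rfl, (g a).lower hyx hx⟩⟩

end Extension

end RelPCA

theorem mainTheorem3 {A : Type u} [PartialOrder A] (P : RelPCA.PCA A) (hP : ¬ P.Semitrivial)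
    (hA : RelPCA.ChainComplete A) (F : RelPCA.Fn2 A) :
    ∃ f : RelPCA.Fn A,
      -- `f` is the largest fixpoint of `F̃`
      IsGreatest {α : RelPCA.Fn A | P.tilde hP F α = α} f ∧
      -- `A[f]` is a (non-semitrivial) PCA, and `ι_f : A → A[f]` is a total applicative morphism
      (∃ Q : RelPCA.PCA A, Q.toPAS = P.adjoin hP f ∧ ¬ Q.Semitrivial) ∧
      RelPCA.IsPAM P.toPAS (P.adjoin hP f) (RelPCA.iota A) ∧
      RelPCA.IsTotal (RelPCA.iota A) ∧
      -- (i)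
      RelPCA.EffRepresentable2 (P.adjoin hP f) (RelPCA.iota A) F ∧
      -- (ii)
      ∀ {B : Type v} [PartialOrder B] (Q : RelPCA.PCA B) (g : A → LowerSet B),
        RelPCA.IsPAM P.toPAS Q.toPAS g →
        RelPCA.IsDecidable P Q g →
        RelPCA.ChainContinuous g →
        RelPCA.EffRepresentable2 Q.toPAS g F →
        ∃ h : A → LowerSet B,
          RelPCA.IsPAM (P.adjoin hP f) Q.toPAS h ∧
          RelPCA.MorEquiv Q.toPAS (RelPCA.morComp h (RelPCA.iota A)) g := by
  obtain ⟨f, hf, hind⟩ := RelPCA.exists_greatest_fixpoint (RelPCA.Fn.chainComplete hA)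
    RelPCA.Fn.isTop_empty (P.tilde hP F)
  refine ⟨f, hf, ⟨P.adjoinPCA hP f, rfl, P.adjoinPCA_not_semitrivial hP f⟩,
    RelPCA.isPAM_iota P hP f, fun a => ⟨a, le_refl a⟩, RelPCA.effRepresentable2_iota P hP hf.1, ?_⟩
  intro B _ Q g hg hd hc hF
  obtain ⟨β, hβ, h0, h1, h2⟩ := hg.exists_represents hP hA hd hc hF
  exact ⟨g, hg.adjoin hP hd hβ (hind _ h0 h1 h2), hg.morEquiv_comp_iota⟩
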